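/- Let $p\in[0,1)$ and $q=2p-1\in[-1,1)$. Let $D_\infty=\langle a,b\mid a^2=e,\ b^2=e\rangle$ be the infinite dihedral group with the word metric $\rho$ of its left Cayley graph: $\rho(x,y)$ is the least length of a word in $a,b$ representing $yx^{-1}$. The elephant random walk $(w_n)_{n\ge0}$ on $D_\infty$ with memory parameter $p$ is $w_0=e$, $w_n=g_n\cdots g_1$, where the steps $g_1,g_2,\dots\in\{a,b\}$ are random: $g_1$ is uniform on $\{a,b\}$ and, given $\mathcal F_n=\sigma(g_1,\dots,g_n)$ with $n\ge1$, an index $I_{n+1}$ is drawn uniformly from $\{1,\dots,n\}$ and, independently of the choice of index, $g_{n+1}=g_{I_{n+1}}$ with probability $p$ and $g_{n+1}$ is the other letter than $g_{I_{n+1}}$ with probability $1-p$. Put $\Delta_n=\rho(w_n,e)$ and let the signed location be $\Delta^{(s)}_n=\Delta_n$ if $\rho(w_n,a)\le\rho(w_n,b)$ and $\Delta^{(s)}_n=-\Delta_n$ otherwise. Let $A_n$ and $B_n$ be the numbers of $a$'s and of $b$'s among $g_1,\dots,g_n$, and let $W_n=A_n-B_n$ (the elephant random walk on $\mathbb Z$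 with the same steps). Then there is a zero-mean martingale $(\Xi_n)_{n\ge0}$ with respect to $(\mathcal F_n)_{n\ge0}$ with bounded increments, whose predictable quadratic variation $\langle\Xi\rangle_n=\sum_{k=1}^n\mathbb E[(\Xi_k-\Xi_{k-1})^2\mid\mathcal F_{k-1}]$ satisfies $\langle\Xi\rangle_n/n\to1$ almost surely, such that for all $n\ge0$ $$\Delta^{(s)}_n=\Xi_n+q\sum_{k=1}^{n-1}(-1)^k\frac{W_k}{k}.$$ The process $Z_n:=\Delta^{(s)}_n-\Xi_n$ is predictable. The series $\sum_{k=1}^\infty(-1)^kW_k/k$ converges almost surely, and $Z_n$ converges almost surely and in $L^2$ to the zero-mean random variable $$Z_\infty:=q\sum_{k=1}^\infty(-1)^k\frac{W_k}{k},$$ whose variance is $$\mathbb E[Z_\infty^2]=\begin{cases}\dfrac{q^2}{2q-1}\displaystyle\int_0^1\frac{u^{-2q+1}-1}{1-u}\cdot\frac{(1-\frac u2)^{q-1}-1}{u}\,du&\text{if }q\ne\frac12,\\[2ex]\dfrac14\displaystyle\int_0^1\frac{-\ln u}{1-u}\cdot\frac{(1-\frac u2)^{-1/2}-1}{u}\,du&\text{if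 }q=\frac12,\end{cases}$$ where the integrals converge absolutely. -/

import Mathlib

open MeasureTheory ProbabilityTheory Filter Topology

noncomputable section

namespace DihedralERW

/-! ### The infinite dihedral group with its word metric -/

/-- The two letters: `true` stands for `a` and `false` for `b`. The complementary letter
(`a ↦ b`, `b ↦ a`) of `s` is `!s`. -/
abbrev Letter : Type := Bool

/-- The letter `a`. -/
abbrev letterA : Letter := true

/-- The letter `b`. -/
abbrev letterB : Letter := false

/-- The infinite dihedral group `⟨a, b ∣ a² = e, b² = e⟩`. -/
abbrev DInf : Type :=
  PresentedGroup {r : FreeGroup Letter | ∃ s : Letter, r = FreeGroup.of s ^ 2}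

/-- The generator of the infinite dihedral group given by a letter. -/
def gen (s : Letter) : DInf := PresentedGroup.of s

/-- The length of a shortest word in the letters `a`, `b` representing `x`. As both generators
are involutions, inverses of letters are not needed. -/
def wordLength (x : DInf) : ℕ :=
  sInf {n : ℕ | ∃ l : List Letter, l.length = n ∧ (l.map gen).prod = x}

/-- The word metric of the left Cayley graph: the word length of `y x⁻¹`. -/
def wordDist (x y : DInf) : ℕ := wordLength (y * x⁻¹)

/-- The signed distance of `x` from the identity; the branch of the Cayley graph that
contains `a` is the positive one. -/
def signedDist (x : DInf) : ℤ :=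
  if wordDist x (gen letterA) ≤ wordDist x (gen letterB) then (wordDist x 1 : ℤ)
  else -(wordDist x 1 : ℤ)

/-! ### The elephant random walk -/

variable {Ω : Type*} {m : MeasurableSpace Ω}

/-- The natural filtration `σ(g₁, …, gₙ)` of the steps; the value `g 0` plays no role. -/
def stepFiltration (g : ℕ → Ω → Letter) (hg : ∀ k, Measurable (g k)) : Filtration ℕ m where
  seq n := ⨆ k ∈ Finset.Icc 1 n, MeasurableSpace.comap (g k) inferInstance
  mono' := fun _ _ h => biSup_mono fun _ hk => Finset.Icc_subset_Icc_right h hk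
  le' := fun _ => iSup₂_le fun k _ => (hg k).comap_le

/-- The steps `g 1, g 2, …` of an elephant random walk with memory parameter `p`. The first step is
uniform. Given the first `n` steps, an index `I (n + 1)` is chosen uniformly from `{1, …, n}` and,
independently of it, a coin `c (n + 1)` shows `true` with probability `p`; the step `n + 1` repeats
the step `I (n + 1)` if the coin shows `true`, and is the complementary letter otherwise. -/
structure IsElephantSteps (p : ℝ) (μ : Measure Ω) (g : ℕ → Ω → Letter) (I : ℕ → Ω → ℕ)
    (c : ℕ → Ω → Bool) : Prop where
  measurable_step : ∀ k, Measurable (g k)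
  measurable_index : ∀ k, Measurable (I k)
  measurable_coin : ∀ k, Measurable (c k)
  first : μ {ω | g 1 ω = letterA} = 1 / 2
  choose_repeat : ∀ n : ℕ, 1 ≤ n → ∀ i ∈ Finset.Icc 1 n,
    μ⟦{ω | I (n + 1) ω = i ∧ c (n + 1) ω = true} | stepFiltration g measurable_step n⟧
      =ᵐ[μ] fun _ => p / n
  choose_flip : ∀ n : ℕ, 1 ≤ n → ∀ i ∈ Finset.Icc 1 n,
    μ⟦{ω | I (n + 1) ω = i ∧ c (n + 1) ω = false} | stepFiltration g measurable_step n⟧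
      =ᵐ[μ] fun _ => (1 - p) / n
  step : ∀ n : ℕ, 1 ≤ n → ∀ᵐ ω ∂μ,
    g (n + 1) ω = if c (n + 1) ω = true then g (I (n + 1) ω) ω else !(g (I (n + 1) ω) ω)

/-- The position `gₙ ⋯ g₁` of the walker in the infinite dihedral group at time `n`. -/
def position (g : ℕ → Ω → Letter) : ℕ → Ω → DInf
  | 0, _ => 1
  | n + 1, ω => gen (g (n + 1) ω) * position g n ω

/-- The signed location of the walker at time `n`. -/
def signedLocation (g : ℕ → Ω → Letter) (n : ℕ) (ω : Ω) : ℤ := signedDist (position g n ω)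

/-- The number of steps up to time `n` that are equal to the letter `s`. -/
def letterCount (g : ℕ → Ω → Letter) (s : Letter) (n : ℕ) (ω : Ω) : ℕ :=
  ((Finset.Icc 1 n).filter fun k => g k ω = s).card

/-- The elephant random walk on `ℤ` with the same steps (`a` is `+1`, `b` is `-1`):
the number of `a`-steps minus the number of `b`-steps. -/
def elephantZ (g : ℕ → Ω → Letter) (n : ℕ) (ω : Ω) : ℤ :=
  (letterCount g letterA n ω : ℤ) - (letterCount g letterB n ω : ℤ)

/-- The sum `∑_{k=1}^{n-1} (-1)^k W_k / k`, where `W` is the elephant random walk on `ℤ`. -/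
def alternatingSum (g : ℕ → Ω → Letter) (n : ℕ) (ω : Ω) : ℝ :=
  ∑ k ∈ Finset.Ico 1 n, (-1 : ℝ) ^ k * ((elephantZ g k ω : ℝ) / (k : ℝ))

/-- The predictable quadratic variation `∑_{k=1}^{n} E[(X_k - X_{k-1})² ∣ ℱ_{k-1}]`. -/
def predictableQuadVar (X : ℕ → Ω → ℝ) (ℱ : Filtration ℕ m) (μ : Measure Ω) (n : ℕ) (ω : Ω) : ℝ :=
  ∑ k ∈ Finset.range n, (μ[fun ω' => (X (k + 1) ω' - X k ω') ^ 2 | ℱ k]) ω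

end DihedralERW

end

open DihedralERW

/-!
The parity of the signed location is the parity of the time, so the step `n + 1`, with sign
`σ = ±1` (`a` counts `1`), moves the signed location by `(-1) ^ n * σ` (`signedLocation_eq_sum`).
Given the past, `σ` has mean `q * W n / n` (`IsElephantSteps.condExp_stepSign`). The centred signs
("innovations") are bounded martingale differences, and `Ξ` is the transform of them with the
weights `(-1) ^ n`. What remains is `q` times the alternating sum of the `W k / k`. The conditional
variance of an innovation is `1 - q ^ 2 * (W n / n) ^ 2`, so the bracket of `Ξ` is asymptotically
linear once `W n / n → 0`; this law of large numbers follows from the almost sure convergence of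
the transform with weights `1 / (n + 1)`, by the deterministic lemma `tendsto_zero_of_contraction`.

For the alternating sum, let `e` be the solution of `k * e k + (k + q) * e (k + 1) = 1` that tends
to zero (`dualCoeff`). Then `∑_{k < n} (-1) ^ k * W k / k + (-1) ^ n * e n * W n` is the transform
with the square summable weights `(-1) ^ (n + 1) * e (n + 1)` (`transform_limitWeight`). It
therefore converges almost surely and in `L²`, and the correction `e n * W n`, at most `|W n| / n`,
is negligible.

For the variance, put `b k = E[W k ^ 2] / k`. By orthogonality of martingale differences and the
recursions of `e` and of the second moments, the limit has variance `∑ₖ b k * (2 * e k - 1 / k)`.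
Here `2 * e k - 1 / k = ∑_{n ≥ 1} wₙ * B(k, n + 1)` with the beta function `B` and the coefficients
`wₙ` of the power series of `(1 - u / 2) ^ (q - 1)`. Summation by parts against the recursion of the
second moments gives `∑ₖ b k * B(k, n + 1) = ∑_{N ≥ n} 1 / (N * (N + 1 - 2 * q))`
(`hasSum_kernelMoment`), and `1 / (N * (N + 1 - 2 * q)) = ∫₀¹ ψ(u) * u ^ (N - 1) du` with
`ψ(u) = (u ^ (1 - 2 * q) - 1) / (2 * q - 1)`, or `-log u` if `q = 1 / 2`. All these series have
nonnegative terms, so they may be summed under the integral sign (`variance_integral`).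
-/

noncomputable section

namespace DihedralERW

/-! ### The signed location as an alternating sum of steps -/

/-- The action of a letter on the integers that label the vertices of the left Cayley graph by
their signed location: `a` exchanges `2k` and `2k + 1`, and `b` exchanges `2k` and `2k - 1`. -/
def letterMove (s : Letter) (z : ℤ) : ℤ :=
  if Even z then (if s = letterA then z + 1 else z - 1)
  else (if s = letterA then z - 1 else z + 1)

lemma letterMove_involutive (s : Letter) : Function.Involutive (letterMove s) := by
  intro z
  rcases Int.even_or_odd z with hz | hz
  · have h1 : ¬ Even (z + 1) := by simpa [Int.even_add_one] using hz
    have h2 : ¬ Even (z - 1) := by simpa [Int.even_sub_one] using hz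
    cases s <;> simp [letterMove, hz, h1, h2]
  · have hz' : ¬ Even z := by simpa using hz
    have h1 : Even (z + 1) := by simpa [Int.even_add_one] using hz
    have h2 : Even (z - 1) := by simpa [Int.even_sub_one] using hz
    cases s <;> simp [letterMove, hz', h1, h2]

lemma abs_letterMove_le (s : Letter) (z : ℤ) : |letterMove s z| ≤ |z| + 1 := by
  unfold letterMove
  have h1 := abs_add_le z 1
  have h2 := abs_sub z 1
  simp only [abs_one] at h1 h2
  split_ifs <;> assumption

/-- The action of the infinite dihedral group on the integers through `letterMove`. It is the
left regular action, transported to the signed locations. -/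
def coordHom : DInf →* Equiv.Perm ℤ :=
  PresentedGroup.toGroup (f := fun s => (letterMove_involutive s).toPerm) <| by
    rintro r ⟨s, rfl⟩
    ext z
    simp [pow_two, (letterMove_involutive s) z]

lemma coordHom_gen (s : Letter) (z : ℤ) : coordHom (gen s) z = letterMove s z := by
  simp [coordHom, gen]

lemma abs_coordHom_prod_le (l : List Letter) :
    |coordHom (l.map gen).prod 0| ≤ (l.length : ℤ) := by
  induction l with
  | nil => simp
  | cons s l ih =>
    simp only [List.map_cons, List.prod_cons, map_mul, Equiv.Perm.mul_apply, coordHom_gen,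
      List.length_cons, Nat.cast_add, Nat.cast_one]
    exact (abs_letterMove_le _ _).trans (by linarith)

lemma gen_mul_self (s : Letter) : gen s * gen s = 1 := by
  have : (PresentedGroup.mk {r : FreeGroup Letter | ∃ s : Letter, r = FreeGroup.of s ^ 2})
      (FreeGroup.of s ^ 2) = 1 := PresentedGroup.one_of_mem ⟨s, rfl⟩
  rwa [pow_two, map_mul] at this

lemma gen_inv (s : Letter) : (gen s)⁻¹ = gen s :=
  inv_eq_of_mul_eq_one_left (gen_mul_self s)

/-- The alternating word of length `n` whose rightmost letter is `s`. -/
def altList (s : Letter) : ℕ → List Letter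
  | 0 => []
  | n + 1 => (if Even n then s else !s) :: altList s n

/-- The element of the infinite dihedral group represented by an alternating word. -/
def altWord (s : Letter) (n : ℕ) : DInf := ((altList s n).map gen).prod

lemma altWord_zero (s : Letter) : altWord s 0 = 1 := rfl

lemma altWord_succ (s : Letter) (n : ℕ) :
    altWord s (n + 1) = gen (if Even n then s else !s) * altWord s n := rfl

lemma length_altList (s : Letter) (n : ℕ) : (altList s n).length = n := by
  induction n with
  | zero => rfl
  | succ n ih => simp [altList, ih]

lemma altWord_succ_eq_mul_gen (s : Letter) (n : ℕ) :
    altWord s (n + 1) = altWord (!s) n * gen s := by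
  induction n with
  | zero => simp [altWord_succ, altWord_zero]
  | succ n ih =>
    rw [altWord_succ, ih, altWord_succ (!s) n, ← mul_assoc]
    congr 3
    rcases Nat.even_or_odd n with hn | hn <;> simp [Nat.even_add_one, hn]

lemma altWord_mul_gen (s : Letter) (n : ℕ) : altWord s n * gen (!s) = altWord (!s) (n + 1) := by
  rw [altWord_succ_eq_mul_gen, Bool.not_not]

lemma altWord_succ_mul_gen (s : Letter) (n : ℕ) : altWord s (n + 1) * gen s = altWord (!s) n := by
  rw [altWord_succ_eq_mul_gen, mul_assoc, gen_mul_self, mul_one]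

lemma coordHom_altWord (s : Letter) (n : ℕ) :
    coordHom (altWord s n) 0 = if s = letterA then (n : ℤ) else -n := by
  induction n with
  | zero => simp [altWord_zero]
  | succ n ih =>
    rw [altWord_succ, map_mul, Equiv.Perm.mul_apply, coordHom_gen, ih]
    rcases Nat.even_or_odd n with hn | hn
    · cases s
      · simp [letterMove, hn]
        ring
      · simp [letterMove, hn]
    · have hn' : ¬ Even n := by simpa using hn
      cases s
      · simp [letterMove, hn']
        ring
      · simp [letterMove, hn']

lemma wordLength_altWord (s : Letter) (n : ℕ) : wordLength (altWord s n) = n := by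
  apply le_antisymm
  · refine Nat.sInf_le ?_
    exact ⟨altList s n, length_altList s n, rfl⟩
  · refine le_csInf ⟨n, altList s n, length_altList s n, rfl⟩ ?_
    rintro k ⟨l, rfl, hl⟩
    have h := abs_coordHom_prod_le l
    rw [hl, coordHom_altWord] at h
    have h' : |if s = letterA then (n : ℤ) else -n| = n := by split_ifs <;> simp
    rw [h'] at h
    exact_mod_cast h

lemma prod_map_gen_reverse {x : DInf} {l : List Letter} (hl : (l.map gen).prod = x) :
    (l.reverse.map gen).prod = x⁻¹ := by
  rw [← hl, List.prod_inv_reverse, List.map_reverse, List.map_map]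
  congr 3
  ext s
  exact (gen_inv s).symm

lemma wordLength_inv (x : DInf) : wordLength x⁻¹ = wordLength x := by
  unfold wordLength
  congr 1
  ext n
  constructor
  · rintro ⟨l, hn, hl⟩
    exact ⟨l.reverse, by simpa using hn, by simpa using prod_map_gen_reverse hl⟩
  · rintro ⟨l, hn, hl⟩
    exact ⟨l.reverse, by simpa using hn, prod_map_gen_reverse hl⟩

lemma wordDist_gen (x : DInf) (s : Letter) : wordDist x (gen s) = wordLength (x * gen s) := by
  rw [wordDist, ← wordLength_inv, mul_inv_rev, inv_inv, gen_inv]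

lemma wordDist_one (x : DInf) : wordDist x 1 = wordLength x := by
  rw [wordDist, one_mul, wordLength_inv]

lemma signedDist_altWord (s : Letter) (n : ℕ) :
    signedDist (altWord s n) = if s = letterA then (n : ℤ) else -n := by
  have key (s : Letter) (n : ℕ) : wordDist (altWord s n) (gen (!s)) = n + 1 := by
    rw [wordDist_gen, altWord_mul_gen, wordLength_altWord]
  have key' (s : Letter) (n : ℕ) : wordDist (altWord s (n + 1)) (gen s) = n := by
    rw [wordDist_gen, altWord_succ_mul_gen, wordLength_altWord]
  unfold signedDist
  rw [wordDist_one, wordLength_altWord]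
  cases n with
  | zero => simp
  | succ n =>
    cases s with
    | false =>
      have h1 := key false (n + 1)
      have h2 := key' false n
      simp only [Bool.not_false] at h1
      rw [if_neg (by rw [h1, h2]; omega)]
      simp
    | true =>
      have h1 := key true (n + 1)
      have h2 := key' true n
      simp only [Bool.not_true] at h1
      rw [if_pos (by rw [h1, h2]; omega)]
      simp

/-- Left multiplication by a letter moves an alternating word to an alternating word, as
prescribed by `letterMove`. -/
lemma exists_gen_mul_altWord (s t : Letter) (n : ℕ) :
    ∃ t' n', gen s * altWord t n = altWord t' n' ∧
      (if t' = letterA then (n' : ℤ) else -n')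
        = letterMove s (if t = letterA then (n : ℤ) else -n) := by
  suffices ∃ t' n', gen s * altWord t n = altWord t' n' by
    obtain ⟨t', n', h⟩ := this
    refine ⟨t', n', h, ?_⟩
    rw [← coordHom_altWord, ← coordHom_altWord, ← h, map_mul, Equiv.Perm.mul_apply, coordHom_gen]
  cases n with
  | zero => exact ⟨s, 1, by simp [altWord_zero, altWord_succ]⟩
  | succ n =>
    by_cases hs : s = if Even n then t else !t
    · refine ⟨t, n, ?_⟩
      rw [altWord_succ, ← mul_assoc, ← hs, gen_mul_self, one_mul]
    · refine ⟨t, n + 2, ?_⟩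
      rw [altWord_succ t (n + 1)]
      congr 2
      rcases Nat.even_or_odd n with hn | hn
      · simp only [hn, if_true] at hs
        simp only [Nat.even_add_one, hn, not_true_eq_false, if_false]
        cases s <;> cases t <;> simp_all
      · have hn' : ¬ Even n := by simpa using hn
        simp only [hn', if_false] at hs
        simp only [Nat.even_add_one, hn', not_false_eq_true, if_true]
        cases s <;> cases t <;> simp_all

/-- The sign of the step `k`: the letter `a` counts `1` and the letter `b` counts `-1`. -/
def stepSign {Ω : Type*} (g : ℕ → Ω → Letter) (k : ℕ) (ω : Ω) : ℝ :=
  if g k ω = letterA then 1 else -1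

lemma exists_position_eq_altWord {Ω : Type*} (g : ℕ → Ω → Letter) (n : ℕ) (ω : Ω) :
    ∃ t k, position g n ω = altWord t k ∧
      ((n : ℤ) - if t = letterA then (k : ℤ) else -k) % 2 = 0 ∧
      (((if t = letterA then (k : ℤ) else -k : ℤ)) : ℝ)
        = ∑ k ∈ Finset.range n, (-1 : ℝ) ^ k * stepSign g (k + 1) ω := by
  induction n with
  | zero => exact ⟨true, 0, by simp [position, altWord_zero]⟩
  | succ n ih =>
    obtain ⟨t, k, hpos, hpar, hsum⟩ := ih
    obtain ⟨t', k', hmul, hmove⟩ := exists_gen_mul_altWord (g (n + 1) ω) t k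
    refine ⟨t', k', by rw [position, hpos, hmul], ?_, ?_⟩
    · rw [hmove]
      generalize (if t = letterA then (k : ℤ) else -k) = z at *
      unfold letterMove
      push_cast
      split_ifs <;> omega
    · rw [hmove, Finset.sum_range_succ, ← hsum]
      generalize (if t = letterA then (k : ℤ) else -k) = z at *
      have hev : Even z ↔ Even n := by
        rw [Int.even_iff, Nat.even_iff]; omega
      unfold letterMove stepSign
      rcases Nat.even_or_odd n with hn | hn
      · rw [if_pos (hev.2 hn), hn.neg_one_pow]
        split_ifs <;> push_cast <;> ring
      · rw [if_neg (by rw [hev]; simpa using hn), hn.neg_one_pow]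
        split_ifs <;> push_cast <;> ring

/-- The parity of the signed location is that of the time, so the `k`-th step moves the signed
location by `(-1) ^ (k - 1)` times its sign. -/
theorem signedLocation_eq_sum {Ω : Type*} (g : ℕ → Ω → Letter) (n : ℕ) (ω : Ω) :
    (signedLocation g n ω : ℝ) = ∑ k ∈ Finset.range n, (-1 : ℝ) ^ k * stepSign g (k + 1) ω := by
  obtain ⟨t, k, hpos, -, hsum⟩ := exists_position_eq_altWord g n ω
  rw [signedLocation, hpos, signedDist_altWord, hsum]

theorem elephantZ_eq_sum {Ω : Type*} (g : ℕ → Ω → Letter) (n : ℕ) (ω : Ω) :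
    (elephantZ g n ω : ℝ) = ∑ k ∈ Finset.Icc 1 n, stepSign g k ω := by
  simp only [elephantZ, letterCount, Finset.card_filter]
  push_cast
  rw [← Finset.sum_sub_distrib]
  refine Finset.sum_congr rfl fun k _ => ?_
  cases h : g k ω <;> simp [stepSign, h]

/-! ### Transforms of bounded martingale differences -/

section MartingaleDifferences

variable {Ω : Type*} {m : MeasurableSpace Ω} {μ : Measure Ω} {ℱ : Filtration ℕ m}

/-- Uniformly bounded martingale differences: `ξ k` is the increment from time `k` to time
`k + 1`. -/
structure IsBoundedMartingaleDiff (ξ : ℕ → Ω → ℝ) (ℱ : Filtration ℕ m) (μ : Measure Ω)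
    (C : ℝ) : Prop where
  stronglyMeasurable : ∀ k, StronglyMeasurable[ℱ (k + 1)] (ξ k)
  abs_bound : ∀ k ω, |ξ k ω| ≤ C
  condExp_eq : ∀ k, μ[ξ k | ℱ k] =ᵐ[μ] 0

/-- The martingale with increments `d k * ξ k`, for deterministic weights `d`. -/
def transform (d : ℕ → ℝ) (ξ : ℕ → Ω → ℝ) (n : ℕ) (ω : Ω) : ℝ :=
  ∑ k ∈ Finset.range n, d k * ξ k ω

lemma integrable_of_abs_le [IsFiniteMeasure μ] {f : Ω → ℝ} {C : ℝ}
    (hf : StronglyMeasurable f) (hC : ∀ ω, |f ω| ≤ C) : Integrable f μ :=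
  Integrable.of_bound hf.aestronglyMeasurable C (ae_of_all _ hC)

lemma integral_condExp_mul_eq [IsFiniteMeasure μ] {f h k : Ω → ℝ} {n : ℕ} {C : ℝ}
    (hf : StronglyMeasurable[ℱ n] f) (hfC : ∀ ω, |f ω| ≤ C) (hh : Integrable h μ)
    (hk : μ[h | ℱ n] =ᵐ[μ] k) : ∫ ω, f ω * h ω ∂μ = ∫ ω, f ω * k ω ∂μ := by
  have h1 := condExp_stronglyMeasurable_mul_of_bound (ℱ.le n) hf hh C (ae_of_all μ hfC)
  rw [show (∫ ω, f ω * h ω ∂μ) = ∫ ω, (f * h) ω ∂μ from rfl, ← integral_condExp (ℱ.le n)]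
  refine integral_congr_ae ?_
  filter_upwards [h1, hk] with ω h2 h3
  rw [h2, Pi.mul_apply, h3]

lemma eLpNorm_two_eq {f : Ω → ℝ} (hf : MemLp f 2 μ) :
    eLpNorm f 2 μ = ENNReal.ofReal (√(∫ ω, f ω ^ 2 ∂μ)) := by
  rw [hf.eLpNorm_eq_integral_rpow_norm two_ne_zero ENNReal.ofNat_ne_top, Real.sqrt_eq_rpow]
  simp

lemma tendsto_integral_sq_of_tendsto_eLpNorm {f : ℕ → Ω → ℝ} {h : Ω → ℝ}
    (hf : ∀ n, MemLp (f n) 2 μ) (hh : MemLp h 2 μ)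
    (hlim : Tendsto (fun n => eLpNorm (fun ω => f n ω - h ω) 2 μ) atTop (𝓝 0)) :
    Tendsto (fun n => ∫ ω, f n ω ^ 2 ∂μ) atTop (𝓝 (∫ ω, h ω ^ 2 ∂μ)) := by
  have key {k : Ω → ℝ} (hk : MemLp k 2 μ) : ‖hk.toLp k‖ ^ 2 = ∫ ω, k ω ^ 2 ∂μ := by
    rw [Lp.norm_toLp, eLpNorm_two_eq hk, ENNReal.toReal_ofReal (Real.sqrt_nonneg _),
      Real.sq_sqrt (integral_nonneg fun _ => sq_nonneg _)]
  have h1 : Tendsto (fun n => (hf n).toLp (f n)) atTop (𝓝 (hh.toLp h)) := by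
    rw [Lp.tendsto_Lp_iff_tendsto_eLpNorm'']
    exact hlim
  have h2 := (h1.norm).pow 2
  rw [key hh] at h2
  exact h2.congr fun n => key (hf n)

lemma tendsto_integral_of_tendsto_eLpNorm_two [IsProbabilityMeasure μ] {f : ℕ → Ω → ℝ}
    {h : Ω → ℝ} (hf : ∀ n, MemLp (f n) 2 μ) (hh : MemLp h 2 μ)
    (hlim : Tendsto (fun n => eLpNorm (fun ω => f n ω - h ω) 2 μ) atTop (𝓝 0)) :
    Tendsto (fun n => ∫ ω, f n ω ∂μ) atTop (𝓝 (∫ ω, h ω ∂μ)) := by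
  refine tendsto_integral_of_L1' h hh.1
    (Eventually.of_forall fun n => (hf n).integrable one_le_two) ?_
  refine tendsto_of_tendsto_of_tendsto_of_le_of_le tendsto_const_nhds hlim (fun _ => zero_le)
    fun n => ?_
  exact eLpNorm_le_eLpNorm_of_exponent_le one_le_two ((hf n).1.sub hh.1)

namespace IsBoundedMartingaleDiff

variable {ξ : ℕ → Ω → ℝ} {C : ℝ}

lemma stronglyMeasurable_sum (hξ : IsBoundedMartingaleDiff ξ ℱ μ C) (d : ℕ → ℝ) (i n : ℕ) :
    StronglyMeasurable[ℱ n] fun ω => ∑ k ∈ Finset.Ico i n, d k * ξ k ω := by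
  refine Finset.stronglyMeasurable_fun_sum _ fun k hk => ?_
  exact ((hξ.stronglyMeasurable k).mono (ℱ.mono (Finset.mem_Ico.1 hk).2)).const_mul _

lemma abs_sum_le (hξ : IsBoundedMartingaleDiff ξ ℱ μ C) (d : ℕ → ℝ) (i n : ℕ) (ω : Ω) :
    |∑ k ∈ Finset.Ico i n, d k * ξ k ω| ≤ ∑ k ∈ Finset.Ico i n, |d k| * C := by
  refine (Finset.abs_sum_le_sum_abs _ _).trans (Finset.sum_le_sum fun k _ => ?_)
  rw [abs_mul]
  exact mul_le_mul_of_nonneg_left (hξ.abs_bound k ω) (abs_nonneg _)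

lemma transform_eq (d : ℕ → ℝ) (n : ℕ) :
    transform d ξ n = fun ω => ∑ k ∈ Finset.Ico 0 n, d k * ξ k ω := by
  ext ω; simp [transform]

lemma stronglyMeasurable_transform (hξ : IsBoundedMartingaleDiff ξ ℱ μ C) (d : ℕ → ℝ) (n : ℕ) :
    StronglyMeasurable[ℱ n] (transform d ξ n) := by
  rw [transform_eq]
  exact hξ.stronglyMeasurable_sum d 0 n

variable [IsProbabilityMeasure μ]

lemma integrable (hξ : IsBoundedMartingaleDiff ξ ℱ μ C) (k : ℕ) : Integrable (ξ k) μ :=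
  integrable_of_abs_le ((hξ.stronglyMeasurable k).mono (ℱ.le _)) (hξ.abs_bound k)

lemma memLp_sum (hξ : IsBoundedMartingaleDiff ξ ℱ μ C) (d : ℕ → ℝ) (i n : ℕ) :
    MemLp (fun ω => ∑ k ∈ Finset.Ico i n, d k * ξ k ω) 2 μ :=
  MemLp.of_bound ((hξ.stronglyMeasurable_sum d i n).mono (ℱ.le _)).aestronglyMeasurable _
    (ae_of_all _ (hξ.abs_sum_le d i n))

lemma memLp_transform (hξ : IsBoundedMartingaleDiff ξ ℱ μ C) (d : ℕ → ℝ) (n : ℕ) :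
    MemLp (transform d ξ n) 2 μ := by
  rw [transform_eq]
  exact hξ.memLp_sum d 0 n

theorem martingale_transform (hξ : IsBoundedMartingaleDiff ξ ℱ μ C) (d : ℕ → ℝ) :
    Martingale (transform d ξ) ℱ μ := by
  refine martingale_of_condExp_sub_eq_zero_nat (hξ.stronglyMeasurable_transform d)
    (fun n => (hξ.memLp_transform d n).integrable one_le_two) fun n => ?_
  have h1 : transform d ξ (n + 1) - transform d ξ n = d n • ξ n := by
    ext ω
    simp [transform, Finset.sum_range_succ]
  rw [h1]
  filter_upwards [condExp_smul (μ := μ) (d n) (ξ n) (ℱ n), hξ.condExp_eq n] with ω h2 h3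
  rw [h2, Pi.smul_apply, h3]
  simp

theorem integral_transform (hξ : IsBoundedMartingaleDiff ξ ℱ μ C) (d : ℕ → ℝ) (n : ℕ) :
    ∫ ω, transform d ξ n ω ∂μ = 0 := by
  have h := (hξ.martingale_transform d).setIntegral_eq (zero_le (a := n)) MeasurableSet.univ
  simp only [Measure.restrict_univ] at h
  rw [← h]
  simp [transform]

/-- Orthogonality of martingale differences. -/
lemma integral_sum_sq (hξ : IsBoundedMartingaleDiff ξ ℱ μ C) (d : ℕ → ℝ) {i n : ℕ} (hin : i ≤ n) :
    ∫ ω, (∑ k ∈ Finset.Ico i n, d k * ξ k ω) ^ 2 ∂μ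
      = ∑ k ∈ Finset.Ico i n, d k ^ 2 * ∫ ω, ξ k ω ^ 2 ∂μ := by
  induction n, hin using Nat.le_induction with
  | base => simp
  | succ n hin ih =>
    have hS := hξ.memLp_sum d i n
    have hξn : MemLp (ξ n) 2 μ :=
      MemLp.of_bound (hξ.integrable n).1 C (ae_of_all _ (hξ.abs_bound n))
    have hcross : ∫ ω, (∑ k ∈ Finset.Ico i n, d k * ξ k ω) * ξ n ω ∂μ = 0 := by
      rw [integral_condExp_mul_eq (hξ.stronglyMeasurable_sum d i n) (hξ.abs_sum_le d i n)
        (hξ.integrable n) (hξ.condExp_eq n)]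
      simp
    have e : (fun ω => (∑ k ∈ Finset.Ico i (n + 1), d k * ξ k ω) ^ 2)
        = fun ω => (∑ k ∈ Finset.Ico i n, d k * ξ k ω) ^ 2
          + (2 * d n * ((∑ k ∈ Finset.Ico i n, d k * ξ k ω) * ξ n ω) + d n ^ 2 * ξ n ω ^ 2) := by
      ext ω
      rw [Finset.sum_Ico_succ_top hin]
      ring
    have hmul := hS.integrable_mul hξn
    rw [e, integral_add hS.integrable_sq, integral_add, integral_const_mul, integral_const_mul,
      hcross, ih, Finset.sum_Ico_succ_top hin]
    · ring
    · exact hmul.const_mul _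
    · exact hξn.integrable_sq.const_mul _
    · exact (hmul.const_mul _).add (hξn.integrable_sq.const_mul _)

theorem integral_transform_sq (hξ : IsBoundedMartingaleDiff ξ ℱ μ C) (d : ℕ → ℝ) (n : ℕ) :
    ∫ ω, transform d ξ n ω ^ 2 ∂μ
      = ∑ k ∈ Finset.range n, d k ^ 2 * ∫ ω, ξ k ω ^ 2 ∂μ := by
  rw [transform_eq, hξ.integral_sum_sq d (zero_le (a := n)), Finset.range_eq_Ico]

lemma integral_sq_le (hξ : IsBoundedMartingaleDiff ξ ℱ μ C) (k : ℕ) :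
    ∫ ω, ξ k ω ^ 2 ∂μ ≤ C ^ 2 := by
  have hξk : MemLp (ξ k) 2 μ :=
    MemLp.of_bound (hξ.integrable k).1 C (ae_of_all _ (hξ.abs_bound k))
  calc ∫ ω, ξ k ω ^ 2 ∂μ ≤ ∫ _, C ^ 2 ∂μ :=
        integral_mono hξk.integrable_sq (integrable_const _) fun ω =>
          sq_le_sq' (abs_le.1 (hξ.abs_bound k ω)).1 (abs_le.1 (hξ.abs_bound k ω)).2
    _ = C ^ 2 := by simp

lemma eLpNorm_sum_le (hξ : IsBoundedMartingaleDiff ξ ℱ μ C) {d : ℕ → ℝ}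
    (hd : Summable fun k => d k ^ 2) {i n : ℕ} (hin : i ≤ n) :
    eLpNorm (fun ω => ∑ k ∈ Finset.Ico i n, d k * ξ k ω) 2 μ
      ≤ ENNReal.ofReal (√(C ^ 2 * ∑' k, d (k + i) ^ 2)) := by
  rw [eLpNorm_two_eq (hξ.memLp_sum d i n), hξ.integral_sum_sq d hin]
  refine ENNReal.ofReal_le_ofReal (Real.sqrt_le_sqrt ?_)
  calc ∑ k ∈ Finset.Ico i n, d k ^ 2 * ∫ ω, ξ k ω ^ 2 ∂μ
      ≤ ∑ k ∈ Finset.Ico i n, C ^ 2 * d k ^ 2 := by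
        refine Finset.sum_le_sum fun k _ => ?_
        rw [mul_comm]
        exact mul_le_mul_of_nonneg_right (hξ.integral_sq_le k) (sq_nonneg _)
    _ = C ^ 2 * ∑ k ∈ Finset.range (n - i), d (k + i) ^ 2 := by
        rw [← Finset.mul_sum, Finset.sum_Ico_eq_sum_range]
        simp only [add_comm]
    _ ≤ _ := by
        refine mul_le_mul_of_nonneg_left ?_ (sq_nonneg _)
        exact ((summable_nat_add_iff i).2 hd).sum_le_tsum _ fun _ _ => sq_nonneg _

/-- A transform with square summable weights converges almost surely and in `L²`. -/
theorem exists_tendsto_transform (hξ : IsBoundedMartingaleDiff ξ ℱ μ C) {d : ℕ → ℝ}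
    (hd : Summable fun k => d k ^ 2) :
    ∃ Y : Ω → ℝ, MemLp Y 2 μ ∧
      (∀ᵐ ω ∂μ, Tendsto (fun n => transform d ξ n ω) atTop (𝓝 (Y ω))) ∧
      Tendsto (fun n => eLpNorm (fun ω => transform d ξ n ω - Y ω) 2 μ) atTop (𝓝 0) := by
  have hsub := (hξ.martingale_transform d).submartingale
  have hbdd (n : ℕ) : eLpNorm (transform d ξ n) 2 μ
      ≤ (Real.toNNReal (√(C ^ 2 * ∑' k, d (k + 0) ^ 2)) : NNReal) := by
    rw [transform_eq]
    exact hξ.eLpNorm_sum_le hd (zero_le (a := n))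
  have hbdd1 (n : ℕ) := (eLpNorm_le_eLpNorm_of_exponent_le (μ := μ) one_le_two
    (hξ.memLp_transform d n).1).trans (hbdd n)
  obtain ⟨Y, hY, hae⟩ : ∃ Y : Ω → ℝ, MemLp Y 2 μ ∧
      ∀ᵐ ω ∂μ, Tendsto (fun n => transform d ξ n ω) atTop (𝓝 (Y ω)) :=
    ⟨_, hsub.memLp_limitProcess hbdd, hsub.ae_tendsto_limitProcess hbdd1⟩
  refine ⟨Y, hY, hae, ?_⟩
  have htail : Tendsto (fun n => ENNReal.ofReal (√(C ^ 2 * ∑' k, d (k + n) ^ 2))) atTop (𝓝 0) := by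
    have h1 := (tendsto_sum_nat_add fun k => d k ^ 2).const_mul (C ^ 2)
    have h2 := ENNReal.tendsto_ofReal ((Real.continuous_sqrt.tendsto _).comp h1)
    simpa using h2
  refine tendsto_of_tendsto_of_tendsto_of_le_of_le tendsto_const_nhds htail (fun _ => zero_le)
    fun n => ?_
  have hfat := Lp.eLpNorm_lim_le_liminf_eLpNorm (p := 2) (μ := μ)
    (f := fun j ω => transform d ξ n ω - transform d ξ (n + j) ω)
    (fun j => (hξ.memLp_transform d n).1.sub (hξ.memLp_transform d (n + j)).1)
    (fun ω => transform d ξ n ω - Y ω) (by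
      filter_upwards [hae] with ω hω
      have := (hω.comp (tendsto_add_atTop_nat n)).const_sub (transform d ξ n ω)
      simpa [Function.comp_def, add_comm] using this)
  refine hfat.trans (liminf_le_of_le (by isBoundedDefault) fun b hb => ?_)
  obtain ⟨j, hj⟩ := hb.exists
  refine hj.trans ?_
  have e : (fun ω => transform d ξ n ω - transform d ξ (n + j) ω)
      = -(fun ω => ∑ k ∈ Finset.Ico n (n + j), d k * ξ k ω) := by
    ext ω
    simp only [transform, Pi.neg_apply]
    rw [Finset.sum_Ico_eq_sub _ (Nat.le_add_right n j)]
    ring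
  rw [e, eLpNorm_neg]
  exact hξ.eLpNorm_sum_le hd (Nat.le_add_right n j)

end IsBoundedMartingaleDiff

end MartingaleDifferences

/-! ### The elephant random walk on the integers and its martingales -/

section Elephant

variable {Ω : Type*} {m : MeasurableSpace Ω} {μ : Measure Ω} {p q : ℝ}
  {g : ℕ → Ω → Letter} {I : ℕ → Ω → ℕ} {c : ℕ → Ω → Bool}

/-- The empirical mean `W n / n` of the first `n` step signs; it is `0` at time `0`. -/
def meanStep (g : ℕ → Ω → Letter) (n : ℕ) (ω : Ω) : ℝ := (elephantZ g n ω : ℝ) / n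

/-- The difference between the sign of step `n + 1` and its conditional mean given the past. -/
def innovation (q : ℝ) (g : ℕ → Ω → Letter) (n : ℕ) (ω : Ω) : ℝ :=
  stepSign g (n + 1) ω - q * meanStep g n ω

lemma stepSign_sq (g : ℕ → Ω → Letter) (k : ℕ) (ω : Ω) : stepSign g k ω ^ 2 = 1 := by
  unfold stepSign; split_ifs <;> norm_num

lemma abs_stepSign (g : ℕ → Ω → Letter) (k : ℕ) (ω : Ω) : |stepSign g k ω| = 1 := by
  unfold stepSign; split_ifs <;> norm_num

lemma elephantZ_zero (g : ℕ → Ω → Letter) (ω : Ω) : elephantZ g 0 ω = 0 := by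
  simp [elephantZ, letterCount]

lemma elephantZ_succ (g : ℕ → Ω → Letter) (n : ℕ) (ω : Ω) :
    (elephantZ g (n + 1) ω : ℝ) = elephantZ g n ω + stepSign g (n + 1) ω := by
  rw [elephantZ_eq_sum, elephantZ_eq_sum, Finset.sum_Icc_succ_top (by omega)]

lemma meanStep_zero (g : ℕ → Ω → Letter) (ω : Ω) : meanStep g 0 ω = 0 := by
  simp [meanStep]

lemma elephantZ_eq_mul_meanStep (g : ℕ → Ω → Letter) (n : ℕ) (ω : Ω) :
    (elephantZ g n ω : ℝ) = n * meanStep g n ω := by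
  rcases Nat.eq_zero_or_pos n with rfl | hn
  · simp [elephantZ_zero]
  · unfold meanStep; field_simp

lemma abs_elephantZ_le (g : ℕ → Ω → Letter) (n : ℕ) (ω : Ω) : |(elephantZ g n ω : ℝ)| ≤ n := by
  rw [elephantZ_eq_sum]
  refine (Finset.abs_sum_le_sum_abs _ _).trans ?_
  simp [abs_stepSign]

lemma abs_meanStep_le (g : ℕ → Ω → Letter) (n : ℕ) (ω : Ω) : |meanStep g n ω| ≤ 1 := by
  rw [meanStep, abs_div, Nat.abs_cast]
  exact div_le_one_of_le₀ (abs_elephantZ_le g n ω) (Nat.cast_nonneg n)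

lemma alternatingSum_eq_sum_range (g : ℕ → Ω → Letter) (n : ℕ) (ω : Ω) :
    alternatingSum g n ω = ∑ k ∈ Finset.range n, (-1 : ℝ) ^ k * meanStep g k ω := by
  cases n with
  | zero => simp [alternatingSum]
  | succ n =>
    rw [Finset.range_eq_Ico, Finset.sum_eq_sum_Ico_succ_bot (Nat.succ_pos n), meanStep_zero]
    simp [alternatingSum, meanStep]

/-- The decomposition of the signed location into a martingale and a predictable part. -/
lemma signedLocation_eq_transform (q : ℝ) (g : ℕ → Ω → Letter) (n : ℕ) (ω : Ω) :
    (signedLocation g n ω : ℝ)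
      = transform (fun k => (-1) ^ k) (innovation q g) n ω + q * alternatingSum g n ω := by
  rw [signedLocation_eq_sum, alternatingSum_eq_sum_range, transform, Finset.mul_sum,
    ← Finset.sum_add_distrib]
  refine Finset.sum_congr rfl fun k _ => ?_
  rw [innovation]
  ring

lemma stronglyMeasurable_stepSign (hg : ∀ k, Measurable (g k)) {k n : ℕ}
    (hk : k ∈ Finset.Icc 1 n) : StronglyMeasurable[stepFiltration g hg n] (stepSign g k) := by
  have hle : MeasurableSpace.comap (g k) inferInstance ≤ stepFiltration g hg n :=
    le_iSup₂ (f := fun k (_ : k ∈ Finset.Icc 1 n) => MeasurableSpace.comap (g k) inferInstance) k hk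
  have h1 : Measurable[stepFiltration g hg n] (g k) := (comap_measurable (g k)).mono hle le_rfl
  exact ((measurable_from_top (f := fun s : Letter => if s = letterA then (1 : ℝ) else -1)).comp
    h1).stronglyMeasurable

lemma stronglyMeasurable_elephantZ (hg : ∀ k, Measurable (g k)) (n : ℕ) :
    StronglyMeasurable[stepFiltration g hg n] fun ω => (elephantZ g n ω : ℝ) := by
  simp only [elephantZ_eq_sum]
  exact Finset.stronglyMeasurable_fun_sum _ fun k hk => stronglyMeasurable_stepSign hg hk

lemma stronglyMeasurable_meanStep (hg : ∀ k, Measurable (g k)) (n : ℕ) :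
    StronglyMeasurable[stepFiltration g hg n] (meanStep g n) := by
  have h := (stronglyMeasurable_elephantZ hg n).mul_const ((n : ℝ)⁻¹)
  simp only [← div_eq_mul_inv] at h
  exact h

/-- The second moment of the elephant random walk on the integers. -/
def secondMoment (μ : Measure Ω) (g : ℕ → Ω → Letter) (n : ℕ) : ℝ :=
  ∫ ω, (elephantZ g n ω : ℝ) ^ 2 ∂μ

lemma secondMoment_zero : secondMoment μ g 0 = 0 := by
  simp [secondMoment, elephantZ_zero]

lemma secondMoment_nonneg (n : ℕ) : 0 ≤ secondMoment μ g n :=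
  integral_nonneg fun _ => sq_nonneg _

lemma integral_meanStep_sq (n : ℕ) :
    ∫ ω, meanStep g n ω ^ 2 ∂μ = secondMoment μ g n / n ^ 2 := by
  simp only [meanStep, div_pow, integral_div, secondMoment]

variable [IsProbabilityMeasure μ]

/-- The index drawn at time `n + 1` lies in `{1, …, n}`, because the probabilities prescribed for
these indices add up to one. -/
lemma IsElephantSteps.ae_index_mem (h : IsElephantSteps p μ g I c) {n : ℕ} (hn : 1 ≤ n) :
    ∀ᵐ ω ∂μ, I (n + 1) ω ∈ Finset.Icc 1 n := by
  have hn0 : (n : ℝ) ≠ 0 := by positivity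
  have hset (i : ℕ) (b : Bool) : MeasurableSet {ω | I (n + 1) ω = i ∧ c (n + 1) ω = b} :=
    (h.measurable_index (n + 1) (measurableSet_singleton i)).inter
      (h.measurable_coin (n + 1) (measurableSet_singleton b))
  have hprob {i : ℕ} {b : Bool} {r : ℝ}
      (hr : μ⟦{ω | I (n + 1) ω = i ∧ c (n + 1) ω = b} | stepFiltration g h.measurable_step n⟧
        =ᵐ[μ] fun _ => r) : μ.real {ω | I (n + 1) ω = i ∧ c (n + 1) ω = b} = r := by
    rw [← integral_indicator_one (hset i b),
      ← integral_condExp ((stepFiltration g h.measurable_step).le n)]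
    exact (integral_congr_ae hr).trans (by simp)
  set S : Set Ω := ⋃ ib ∈ (Finset.Icc 1 n) ×ˢ (Finset.univ : Finset Bool),
    {ω | I (n + 1) ω = ib.1 ∧ c (n + 1) ω = ib.2} with hS
  have hSm : MeasurableSet S := Finset.measurableSet_biUnion _ fun ib _ => hset ib.1 ib.2
  have hS1 : μ.real S = 1 := by
    rw [hS, measureReal_biUnion_finset _ (fun ib _ => hset ib.1 ib.2), Finset.sum_product]
    · have : ∀ i ∈ Finset.Icc 1 n, ∑ b : Bool,
          μ.real {ω | I (n + 1) ω = i ∧ c (n + 1) ω = b} = 1 / n := by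
        intro i hi
        rw [Fintype.sum_bool, hprob (h.choose_repeat n hn i hi), hprob (h.choose_flip n hn i hi)]
        ring
      rw [Finset.sum_congr rfl this]
      simp [hn0]
    · intro x _ y _ hxy
      refine Set.disjoint_left.2 fun ω h1 h2 => hxy ?_
      exact Prod.ext (h1.1.symm.trans h2.1) (h1.2.symm.trans h2.2)
  have hae : ∀ᵐ ω ∂μ, ω ∈ S := by
    have h2 : μ S = 1 := by
      rw [← ENNReal.toReal_eq_one_iff]; exact hS1
    rw [ae_iff]
    exact (prob_compl_eq_zero_iff hSm).2 h2
  filter_upwards [hae] with ω hω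
  simp only [hS, Set.mem_iUnion, Finset.mem_product] at hω
  obtain ⟨ib, hib, hI, -⟩ := hω
  rw [hI]
  exact hib.1

/-- The conditional mean of a step sign: given the past, step `n + 1` has mean `q * W n / n`. -/
theorem IsElephantSteps.condExp_stepSign (h : IsElephantSteps p μ g I c) (hq : q = 2 * p - 1)
    (n : ℕ) :
    μ[stepSign g (n + 1) | stepFiltration g h.measurable_step n]
      =ᵐ[μ] fun ω => q * meanStep g n ω := by
  have hsm (k : ℕ) (hk : 1 ≤ k) : StronglyMeasurable (stepSign g k) :=
    (stronglyMeasurable_stepSign h.measurable_step (Finset.mem_Icc.2 ⟨hk, le_rfl⟩)).mono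
      ((stepFiltration g h.measurable_step).le k)
  rcases Nat.eq_zero_or_pos n with rfl | hn
  · have hbot : (stepFiltration g h.measurable_step) 0 = ⊥ := by
      refine iSup₂_eq_bot.2 fun k hk => ?_
      simp at hk
    rw [hbot, condExp_bot]
    refine ae_of_all _ fun ω => ?_
    simp only [meanStep_zero, mul_zero]
    have hA : MeasurableSet {ω | g 1 ω = letterA} :=
      h.measurable_step 1 (measurableSet_singleton letterA)
    have e : stepSign g (0 + 1) = fun ω => 2 * {ω | g 1 ω = letterA}.indicator 1 ω - 1 := by
      ext ω
      by_cases hω : g 1 ω = letterA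
      · simp [stepSign, hω]
        norm_num
      · simp [stepSign, hω]
    have hi : Integrable (fun ω => 2 * {ω | g 1 ω = letterA}.indicator (1 : Ω → ℝ) ω) μ :=
      ((integrable_const (1 : ℝ)).indicator hA).const_mul 2
    rw [e, integral_sub hi (integrable_const _), integral_const_mul, integral_indicator_one hA, measureReal_def, h.first]
    simp
  · have hn0 : (n : ℝ) ≠ 0 := by positivity
    have hset (i : ℕ) (b : Bool) : MeasurableSet {ω | I (n + 1) ω = i ∧ c (n + 1) ω = b} :=
      (h.measurable_index (n + 1) (measurableSet_singleton i)).inter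
        (h.measurable_coin (n + 1) (measurableSet_singleton b))
    let ind (i : ℕ) (b : Bool) : Ω → ℝ :=
      {ω | I (n + 1) ω = i ∧ c (n + 1) ω = b}.indicator fun _ => 1
    have hind (i : ℕ) (b : Bool) : Integrable (ind i b) μ :=
      (integrable_const (1 : ℝ)).indicator (hset i b)
    have hsplit : stepSign g (n + 1) =ᵐ[μ]
        ∑ i ∈ Finset.Icc 1 n, (stepSign g i * (ind i true - ind i false)) := by
      filter_upwards [h.ae_index_mem hn, h.step n hn] with ω hI hstep
      rw [Finset.sum_apply, Finset.sum_eq_single_of_mem _ hI]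
      · simp only [Pi.mul_apply, Pi.sub_apply, ind, Set.indicator_apply, Set.mem_ofPred_eq, true_and]
        unfold stepSign
        rw [hstep]
        rcases c (n + 1) ω <;> rcases g (I (n + 1) ω) ω <;> simp
      · intro i _ hi
        have hi' : I (n + 1) ω ≠ i := fun h => hi h.symm
        simp [ind, hi']
    have hterm (i : ℕ) (hi : i ∈ Finset.Icc 1 n) :
        μ[stepSign g i * (ind i true - ind i false) | stepFiltration g h.measurable_step n]
          =ᵐ[μ] fun ω => stepSign g i ω * (q / n) := by
      have h1 := condExp_stronglyMeasurable_mul_of_bound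
        ((stepFiltration g h.measurable_step).le n)
        (stronglyMeasurable_stepSign h.measurable_step hi) ((hind i true).sub (hind i false)) 1
        (ae_of_all μ fun ω => (abs_stepSign g i ω).le)
      filter_upwards [h1, condExp_sub (hind i true) (hind i false)
        (stepFiltration g h.measurable_step n), h.choose_repeat n hn i hi,
        h.choose_flip n hn i hi] with ω h2 h3 h4 h5
      rw [h2, Pi.mul_apply, h3, Pi.sub_apply, h4, h5, hq]
      ring
    have hint (i : ℕ) (hi : i ∈ Finset.Icc 1 n) :
        Integrable (stepSign g i * (ind i true - ind i false)) μ :=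
      ((hind i true).sub (hind i false)).bdd_mul (c := 1)
        (hsm i (Finset.mem_Icc.1 hi).1).aestronglyMeasurable
        (ae_of_all μ fun ω => (abs_stepSign g i ω).le)
    refine (condExp_congr_ae hsplit).trans ((condExp_finsetSum hint _).trans ?_)
    have hall : ∀ᵐ ω ∂μ, ∀ i ∈ Finset.Icc 1 n,
        (μ[stepSign g i * (ind i true - ind i false) | stepFiltration g h.measurable_step n]) ω
          = stepSign g i ω * (q / n) :=
      (ae_ball_iff (Finset.countable_toSet _)).2 hterm
    filter_upwards [hall] with ω hω
    rw [Finset.sum_apply, Finset.sum_congr rfl hω, ← Finset.sum_mul, ← elephantZ_eq_sum, meanStep]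
    ring

theorem IsElephantSteps.isBoundedMartingaleDiff (h : IsElephantSteps p μ g I c)
    (hq : q = 2 * p - 1) (hq1 : |q| ≤ 1) :
    IsBoundedMartingaleDiff (innovation q g) (stepFiltration g h.measurable_step) μ 2 where
  stronglyMeasurable k :=
    (stronglyMeasurable_stepSign h.measurable_step (by simp)).sub
      (((stronglyMeasurable_meanStep h.measurable_step k).mono
        ((stepFiltration g h.measurable_step).mono (Nat.le_succ k))).const_mul q)
  abs_bound k ω := by
    refine (abs_sub _ _).trans ?_
    rw [abs_stepSign, abs_mul]
    linarith [mul_le_one₀ hq1 (abs_nonneg _) (abs_meanStep_le g k ω)]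
  condExp_eq k := by
    have hx := stronglyMeasurable_meanStep h.measurable_step k
    have hxi : Integrable (fun ω => q * meanStep g k ω) μ :=
      (integrable_of_abs_le (hx.mono ((stepFiltration g h.measurable_step).le k))
        (abs_meanStep_le g k)).const_mul q
    have hs : Integrable (stepSign g (k + 1)) μ :=
      integrable_of_abs_le ((stronglyMeasurable_stepSign h.measurable_step
        (k := k + 1) (n := k + 1) (by simp)).mono ((stepFiltration g h.measurable_step).le (k + 1)))
        fun ω => (abs_stepSign g (k + 1) ω).le
    have h1 := condExp_sub hs hxi (stepFiltration g h.measurable_step k)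
    rw [condExp_of_stronglyMeasurable ((stepFiltration g h.measurable_step).le k)
      (hx.const_mul q) hxi] at h1
    refine EventuallyEq.trans h1 ?_
    filter_upwards [h.condExp_stepSign hq k] with ω h2
    simp [h2]

/-- The conditional variance of the innovation. -/
theorem IsElephantSteps.condExp_innovation_sq (h : IsElephantSteps p μ g I c)
    (hq : q = 2 * p - 1) (n : ℕ) :
    μ[fun ω => innovation q g n ω ^ 2 | stepFiltration g h.measurable_step n]
      =ᵐ[μ] fun ω => 1 - q ^ 2 * meanStep g n ω ^ 2 := by
  have hx := stronglyMeasurable_meanStep h.measurable_step n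
  have hle := (stepFiltration g h.measurable_step).le n
  have hs : Integrable (stepSign g (n + 1)) μ :=
    integrable_of_abs_le ((stronglyMeasurable_stepSign h.measurable_step
      (k := n + 1) (n := n + 1) (by simp)).mono ((stepFiltration g h.measurable_step).le (n + 1)))
      fun ω => (abs_stepSign g (n + 1) ω).le
  have hxb (ω : Ω) : ‖meanStep g n ω‖ ≤ 1 := abs_meanStep_le g n ω
  have hxs : Integrable (meanStep g n * stepSign g (n + 1)) μ :=
    hs.bdd_mul (hx.mono hle).aestronglyMeasurable (ae_of_all μ hxb)
  have hr : StronglyMeasurable[stepFiltration g h.measurable_step n]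
      fun ω => 1 + q ^ 2 * meanStep g n ω ^ 2 :=
    stronglyMeasurable_const.add ((hx.pow 2).const_mul _)
  have hri : Integrable (fun ω => 1 + q ^ 2 * meanStep g n ω ^ 2) μ := by
    refine integrable_of_abs_le (C := 1 + q ^ 2) (hr.mono hle) fun ω => ?_
    rw [abs_of_nonneg (by positivity)]
    have h1 : meanStep g n ω ^ 2 ≤ 1 := by
      rw [sq_le_one_iff_abs_le_one]; exact abs_meanStep_le g n ω
    nlinarith [sq_nonneg q]
  have e : (fun ω => innovation q g n ω ^ 2)
      = (fun ω => 1 + q ^ 2 * meanStep g n ω ^ 2)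
        - (2 * q) • (meanStep g n * stepSign g (n + 1)) := by
    ext ω
    have := stepSign_sq g (n + 1) ω
    simp only [innovation, Pi.sub_apply, Pi.smul_apply, Pi.mul_apply, smul_eq_mul]
    linear_combination this
  rw [e]
  have h1 := condExp_sub hri (hxs.smul (2 * q)) (stepFiltration g h.measurable_step n)
  rw [condExp_of_stronglyMeasurable hle hr hri] at h1
  filter_upwards [h1, condExp_smul (μ := μ) (2 * q) (meanStep g n * stepSign g (n + 1))
      (stepFiltration g h.measurable_step n),
    condExp_stronglyMeasurable_mul_of_bound hle hx hs 1 (ae_of_all μ hxb),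
    h.condExp_stepSign hq n] with ω h2 h3 h4 h5
  rw [h2, Pi.sub_apply, h3, Pi.smul_apply, h4, Pi.mul_apply, h5, smul_eq_mul]
  ring

lemma memLp_elephantZ (hg : ∀ k, Measurable (g k)) (n : ℕ) :
    MemLp (fun ω => (elephantZ g n ω : ℝ)) 2 μ :=
  MemLp.of_bound ((stronglyMeasurable_elephantZ hg n).mono
    ((stepFiltration g hg).le n)).aestronglyMeasurable _ (ae_of_all _ (abs_elephantZ_le g n))

/-- The recursion for the second moment; at `n = 0` it reads `E W₁² = 1`, with `q / 0 = 0`. -/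
theorem IsElephantSteps.secondMoment_succ (h : IsElephantSteps p μ g I c) (hq : q = 2 * p - 1)
    (n : ℕ) : secondMoment μ g (n + 1) = (1 + 2 * q / n) * secondMoment μ g n + 1 := by
  have hs : MemLp (stepSign g (n + 1)) 2 μ :=
    MemLp.of_bound ((stronglyMeasurable_stepSign h.measurable_step
      (k := n + 1) (n := n + 1) (by simp)).mono
      ((stepFiltration g h.measurable_step).le (n + 1))).aestronglyMeasurable 1
      (ae_of_all _ fun ω => (abs_stepSign g (n + 1) ω).le)
  have hW := memLp_elephantZ (μ := μ) h.measurable_step n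
  have hcross : ∫ ω, (elephantZ g n ω : ℝ) * stepSign g (n + 1) ω ∂μ
      = q / n * secondMoment μ g n := by
    rw [integral_condExp_mul_eq (stronglyMeasurable_elephantZ h.measurable_step n)
      (abs_elephantZ_le g n) (hs.integrable one_le_two) (h.condExp_stepSign hq n), secondMoment,
      ← integral_const_mul]
    congr 1
    ext ω
    rw [meanStep]
    ring
  have e : (fun ω => (elephantZ g (n + 1) ω : ℝ) ^ 2)
      = fun ω => (elephantZ g n ω : ℝ) ^ 2
        + (2 * ((elephantZ g n ω : ℝ) * stepSign g (n + 1) ω) + 1) := by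
    ext ω
    rw [elephantZ_succ]
    linear_combination stepSign_sq g (n + 1) ω
  have hmul : Integrable (fun ω => 2 * ((elephantZ g n ω : ℝ) * stepSign g (n + 1) ω)) μ :=
    (hW.integrable_mul hs).const_mul 2
  have hmul1 : Integrable
      (fun ω => 2 * ((elephantZ g n ω : ℝ) * stepSign g (n + 1) ω) + 1) μ :=
    hmul.add (integrable_const 1)
  rw [secondMoment, e, integral_add hW.integrable_sq hmul1,
    integral_add hmul (integrable_const 1), integral_const_mul, hcross, ← secondMoment]
  simp
  ring

theorem IsElephantSteps.integral_innovation_sq (h : IsElephantSteps p μ g I c)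
    (hq : q = 2 * p - 1) (n : ℕ) :
    ∫ ω, innovation q g n ω ^ 2 ∂μ = 1 - q ^ 2 * (secondMoment μ g n / n ^ 2) := by
  have hx := stronglyMeasurable_meanStep h.measurable_step n
  have hxi : Integrable (fun ω => meanStep g n ω ^ 2) μ :=
    (MemLp.of_bound (hx.mono ((stepFiltration g h.measurable_step).le n)).aestronglyMeasurable 1
      (ae_of_all _ (abs_meanStep_le g n))).integrable_sq
  rw [← integral_condExp ((stepFiltration g h.measurable_step).le n),
    integral_congr_ae (h.condExp_innovation_sq hq n),
    integral_sub (integrable_const 1) (hxi.const_mul _), integral_const_mul, integral_meanStep_sq]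
  simp

end Elephant

/-! ### The coefficients of the limit martingale -/

section Coefficients

variable {q : ℝ}

/-- The quotient `(1 - q)ₙ / (k + 1)ₙ` of rising factorials. -/
def pochRatio (q : ℝ) (k n : ℕ) : ℝ :=
  ∏ i ∈ Finset.range n, ((i : ℝ) + 1 - q) / (k + 1 + i)

lemma pochRatio_zero (q : ℝ) (k : ℕ) : pochRatio q k 0 = 1 := by simp [pochRatio]

lemma pochRatio_succ (q : ℝ) (k n : ℕ) :
    pochRatio q k (n + 1) = pochRatio q k n * (((n : ℝ) + 1 - q) / (k + 1 + n)) := by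
  rw [pochRatio, Finset.prod_range_succ, ← pochRatio]

lemma pochRatio_nonneg (hq1 : q ≤ 1) (k n : ℕ) : 0 ≤ pochRatio q k n :=
  Finset.prod_nonneg fun i _ => div_nonneg (by linarith [(Nat.cast_nonneg i : (0 : ℝ) ≤ i)])
    (by positivity)

lemma pochRatio_le_one (hq0 : -1 ≤ q) (hq1 : q ≤ 1) {k : ℕ} (hk : 1 ≤ k) (n : ℕ) :
    pochRatio q k n ≤ 1 := by
  have hk' : (1 : ℝ) ≤ k := by exact_mod_cast hk
  refine Finset.prod_le_one (fun i _ => div_nonneg ?_ (by positivity)) fun i _ =>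
    div_le_one_of_le₀ (by linarith) (by positivity)
  linarith [(Nat.cast_nonneg i : (0 : ℝ) ≤ i)]

lemma pochRatio_succ_left (q : ℝ) (k n : ℕ) :
    pochRatio q (k + 1) n = pochRatio q k n * ((k + 1) / (k + 1 + n)) := by
  induction n with
  | zero =>
    have : (k : ℝ) + 1 ≠ 0 := by positivity
    simp [pochRatio_zero, this]
  | succ n ih =>
    rw [pochRatio_succ, pochRatio_succ, ih]
    have h1 : (k : ℝ) + 1 + n ≠ 0 := by positivity
    have h2 : (k : ℝ) + 1 + 1 + n ≠ 0 := by positivity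
    push_cast
    field_simp
    ring

lemma summable_half_pow_mul_pochRatio (hq0 : -1 ≤ q) (hq1 : q ≤ 1) {k : ℕ} (hk : 1 ≤ k) :
    Summable fun n => (1 / 2 : ℝ) ^ n * pochRatio q k n := by
  refine Summable.of_nonneg_of_le (fun n => mul_nonneg (by positivity) (pochRatio_nonneg hq1 k n))
    (fun n => ?_) summable_geometric_two
  exact mul_le_of_le_one_right (by positivity) (pochRatio_le_one hq0 hq1 hk n)

/-- The solution of the recursion `k * e k + (k + q) * e (k + 1) = 1` that tends to `0`. It makes
`∑_{k < n} (-1) ^ k * W k / k + (-1) ^ n * e n * W n` a martingale. The series is the Euler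
transform of the alternating series obtained by iterating the recursion. -/
def dualCoeff (q : ℝ) (k : ℕ) : ℝ :=
  (1 / (2 * k)) * ∑' n, (1 / 2 : ℝ) ^ n * pochRatio q k n

lemma dualCoeff_nonneg (hq1 : q ≤ 1) (k : ℕ) : 0 ≤ dualCoeff q k :=
  mul_nonneg (by positivity) (tsum_nonneg fun n =>
    mul_nonneg (by positivity) (pochRatio_nonneg hq1 k n))

lemma dualCoeff_le (hq0 : -1 ≤ q) (hq1 : q ≤ 1) {k : ℕ} (hk : 1 ≤ k) : dualCoeff q k ≤ 1 / k := by
  have hk' : (0 : ℝ) < k := by exact_mod_cast hk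
  have h1 : ∑' n, (1 / 2 : ℝ) ^ n * pochRatio q k n ≤ 2 := by
    refine ((summable_half_pow_mul_pochRatio hq0 hq1 hk).tsum_le_tsum (fun n => ?_)
      summable_geometric_two).trans_eq tsum_geometric_two
    exact mul_le_of_le_one_right (by positivity) (pochRatio_le_one hq0 hq1 hk n)
  calc dualCoeff q k ≤ (1 / (2 * k)) * 2 := mul_le_mul_of_nonneg_left h1 (by positivity)
    _ = 1 / k := by field_simp

theorem dualCoeff_recursion (hq0 : -1 ≤ q) (hq1 : q ≤ 1) {k : ℕ} (hk : 1 ≤ k) :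
    k * dualCoeff q k + (k + q) * dualCoeff q (k + 1) = 1 := by
  have hk' : (0 : ℝ) < k := by exact_mod_cast hk
  have hs := summable_half_pow_mul_pochRatio hq0 hq1 hk
  have hs' := summable_half_pow_mul_pochRatio hq0 hq1 (Nat.le_succ_of_le hk)
  have hs1 := (summable_nat_add_iff 1).2 hs
  have e1 : (k : ℝ) * dualCoeff q k = ∑' n, (1 / 2 : ℝ) * ((1 / 2 : ℝ) ^ n * pochRatio q k n) := by
    rw [dualCoeff, tsum_mul_left]; field_simp
  -- The terms of the second series telescope against those of the first.
  have e2 : ((k : ℝ) + q) * dualCoeff q (k + 1)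
      = ∑' n, ((1 / 2 : ℝ) * ((1 / 2 : ℝ) ^ n * pochRatio q k n)
          - (1 / 2 : ℝ) ^ (n + 1) * pochRatio q k (n + 1)) := by
    rw [dualCoeff, ← mul_assoc, ← tsum_mul_left]
    refine tsum_congr fun n => ?_
    rw [pochRatio_succ_left, pochRatio_succ]
    have h1 : (k : ℝ) + 1 + n ≠ 0 := by positivity
    have h2 : (k : ℝ) + 1 ≠ 0 := by positivity
    push_cast
    rw [pow_succ]
    field_simp
    ring
  rw [e1, e2, (hs.mul_left (1 / 2)).tsum_sub hs1, tsum_mul_left, hs.tsum_eq_zero_add]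
  simp [pochRatio_zero]
  ring

lemma hasSum_two_mul_dualCoeff_sub (hq0 : -1 ≤ q) (hq1 : q ≤ 1) {k : ℕ} (hk : 1 ≤ k) :
    HasSum (fun n => (1 / k : ℝ) * ((1 / 2 : ℝ) ^ (n + 1) * pochRatio q k (n + 1)))
      (2 * dualCoeff q k - 1 / k) := by
  have hk' : (0 : ℝ) < k := by exact_mod_cast hk
  have hs := summable_half_pow_mul_pochRatio hq0 hq1 hk
  have h := (((summable_nat_add_iff 1).2 hs).hasSum).mul_left (1 / k : ℝ)
  have e : 2 * dualCoeff q k - 1 / k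
      = (1 / k) * ∑' n, (1 / 2 : ℝ) ^ (n + 1) * pochRatio q k (n + 1) := by
    rw [dualCoeff, hs.tsum_eq_zero_add, pochRatio_zero]
    field_simp
    ring
  rw [e]
  exact h

/-- The value `n! / (k (k + 1) ⋯ (k + n))` of the beta function at `(k, n + 1)`. -/
def betaCoeff (n k : ℕ) : ℝ :=
  (1 / k) * ∏ i ∈ Finset.range n, ((i : ℝ) + 1) / (k + 1 + i)

lemma betaCoeff_nonneg (n k : ℕ) : 0 ≤ betaCoeff n k :=
  mul_nonneg (by positivity) (Finset.prod_nonneg fun i _ => by positivity)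

lemma betaCoeff_succ (n k : ℕ) :
    betaCoeff (n + 1) k = betaCoeff n k * (((n : ℝ) + 1) / (k + 1 + n)) := by
  rw [betaCoeff, Finset.prod_range_succ, ← mul_assoc, ← betaCoeff]

lemma betaCoeff_succ_right {k : ℕ} (hk : 1 ≤ k) (n : ℕ) :
    ((k : ℝ) + n + 1) * betaCoeff n (k + 1) = k * betaCoeff n k := by
  have hk' : (0 : ℝ) < k := by exact_mod_cast hk
  induction n with
  | zero => simp [betaCoeff]; field_simp
  | succ n ih =>
    rw [betaCoeff_succ, betaCoeff_succ]
    have h1 : (k : ℝ) + 1 + n ≠ 0 := by positivity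
    have h2 : (k : ℝ) + 1 + 1 + n ≠ 0 := by positivity
    have e : betaCoeff n (k + 1) = k * betaCoeff n k / (k + n + 1) := by
      rw [eq_div_iff (by positivity), ← ih]; ring
    rw [e]
    push_cast
    field_simp
    ring

/-- Pascal's rule for the beta function. -/
lemma betaCoeff_sub {k : ℕ} (hk : 1 ≤ k) (n : ℕ) :
    betaCoeff n k - betaCoeff (n + 1) k = betaCoeff n (k + 1) := by
  have h := betaCoeff_succ_right hk n
  rw [betaCoeff_succ]
  have h1 : (k : ℝ) + 1 + n ≠ 0 := by positivity
  have h2 : (k : ℝ) + n + 1 ≠ 0 := by positivity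
  rw [eq_comm, ← mul_right_inj' h2, h]
  field_simp
  ring

lemma betaCoeff_antitone {k : ℕ} (hk : 1 ≤ k) : Antitone fun n => betaCoeff n k := by
  refine antitone_nat_of_succ_le fun n => ?_
  linarith [betaCoeff_sub hk n, betaCoeff_nonneg n (k + 1)]

lemma betaCoeff_one_right (n : ℕ) : betaCoeff n 1 = 1 / (n + 1) := by
  induction n with
  | zero => simp [betaCoeff]
  | succ n ih =>
    rw [betaCoeff_succ, ih]
    have : (n : ℝ) + 1 ≠ 0 := by positivity
    push_cast
    field_simp
    ring

lemma betaCoeff_le {k : ℕ} (hk : 1 ≤ k) (n : ℕ) : betaCoeff n k ≤ 1 / (n + 1) := by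
  induction k, hk using Nat.le_induction with
  | base => rw [betaCoeff_one_right]
  | succ k hk ih => linarith [betaCoeff_sub hk n, betaCoeff_nonneg (n + 1) k]

lemma betaCoeff_le_inv {k : ℕ} (hk : 1 ≤ k) (n : ℕ) : betaCoeff n k ≤ 1 / k := by
  refine (betaCoeff_antitone hk (zero_le (a := n))).trans ?_
  simp [betaCoeff]

lemma betaCoeff_le_inv_sq {k : ℕ} (hk : 1 ≤ k) {n : ℕ} (hn : 1 ≤ n) :
    betaCoeff n k ≤ 1 / (k : ℝ) ^ 2 := by
  have hk' : (0 : ℝ) < k := by exact_mod_cast hk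
  refine (betaCoeff_antitone hk hn).trans ?_
  simp only [betaCoeff, Finset.prod_range_one, Nat.cast_zero, zero_add, add_zero]
  rw [div_mul_div_comm, one_mul]
  exact one_div_le_one_div_of_le (by positivity) (by nlinarith)

/-- The coefficient `(1 - q)ₙ / (2ⁿ n!)` of the power series of `(1 - u / 2) ^ (q - 1)`. -/
def binomCoeff (q : ℝ) (n : ℕ) : ℝ :=
  ∏ i ∈ Finset.range n, ((i : ℝ) + 1 - q) / (2 * (i + 1))

lemma binomCoeff_nonneg (hq1 : q ≤ 1) (n : ℕ) : 0 ≤ binomCoeff q n :=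
  Finset.prod_nonneg fun i _ => div_nonneg (by linarith [(Nat.cast_nonneg i : (0 : ℝ) ≤ i)])
    (by positivity)

lemma binomCoeff_mul_betaCoeff (q : ℝ) (k n : ℕ) :
    binomCoeff q n * betaCoeff n k = (1 / k) * ((1 / 2) ^ n * pochRatio q k n) := by
  have h : binomCoeff q n * ∏ i ∈ Finset.range n, ((i : ℝ) + 1) / (k + 1 + i)
      = (1 / 2) ^ n * pochRatio q k n := by
    rw [binomCoeff, pochRatio, ← Finset.prod_mul_distrib]
    conv_rhs => rw [← Finset.card_range n, ← Finset.prod_const, Finset.card_range]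
    rw [← Finset.prod_mul_distrib]
    refine Finset.prod_congr rfl fun i _ => ?_
    have h1 : (i : ℝ) + 1 ≠ 0 := by positivity
    field_simp
  rw [betaCoeff, ← h]
  ring

lemma ascPochhammer_eval_eq_prod (a : ℝ) (n : ℕ) :
    (ascPochhammer ℝ n).eval a = ∏ i ∈ Finset.range n, (a + i) := by
  induction n with
  | zero => simp
  | succ n ih => rw [ascPochhammer_succ_eval, ih, Finset.prod_range_succ]

lemma ring_choose_eq_binomCoeff (q : ℝ) (n : ℕ) :
    Ring.choose (1 - q + n - 1) n = 2 ^ n * binomCoeff q n := by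
  have h1 := Ring.factorial_nsmul_multichoose_eq_ascPochhammer (1 - q) n
  rw [Polynomial.ascPochhammer_smeval_eq_eval, ascPochhammer_eval_eq_prod, nsmul_eq_mul] at h1
  have h2 : Ring.choose (1 - q + n - 1) n = Ring.multichoose (1 - q) n := by
    rw [Ring.choose]
    congr 1
    ring
  have h3 : ((n.factorial : ℕ) : ℝ) = ∏ i ∈ Finset.range n, ((i : ℝ) + 1) := by
    rw [← Finset.prod_range_add_one_eq_factorial]
    push_cast
    rfl
  have h4 : (n.factorial : ℝ) ≠ 0 := by positivity
  rw [h2, ← mul_right_inj' h4, h1, h3, binomCoeff]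
  conv_rhs => rw [← Finset.card_range n, ← Finset.prod_const, Finset.card_range]
  rw [← Finset.prod_mul_distrib, ← Finset.prod_mul_distrib]
  refine Finset.prod_congr rfl fun i _ => ?_
  have h5 : (i : ℝ) + 1 ≠ 0 := by positivity
  field_simp
  ring

lemma hasSum_of_forall_eq {f h : ℕ → ℝ} {S : ℝ} (hh : HasSum h S) (e : ∀ n, f n = h n) :
    HasSum f S := by
  rw [funext e]
  exact hh

theorem hasSum_binomCoeff (q : ℝ) {u : ℝ} (hu0 : 0 ≤ u) (hu1 : u ≤ 1) :
    HasSum (fun n => binomCoeff q n * u ^ n) ((1 - u / 2) ^ (q - 1)) := by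
  have h := (Real.one_div_one_sub_rpow_hasFPowerSeriesOnBall_zero (1 - q)).hasSum
    (y := u / 2) (by
      rw [Metric.mem_eball, edist_zero_right, ← ofReal_norm, Real.norm_eq_abs,
        abs_of_nonneg (by linarith)]
      rw [← ENNReal.ofReal_one]
      exact (ENNReal.ofReal_lt_ofReal_iff one_pos).2 (by linarith))
  simp only [zero_add] at h
  have e : (1 - u / 2) ^ (q - 1) = 1 / (1 - u / 2) ^ (1 - q) := by
    rw [one_div, ← Real.rpow_neg (by linarith), neg_sub]
  rw [e]
  refine hasSum_of_forall_eq h fun n => ?_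
  rw [FormalMultilinearSeries.ofScalars_apply_eq, ring_choose_eq_binomCoeff, smul_eq_mul, div_pow]
  field_simp

lemma summable_binomCoeff (q : ℝ) : Summable (binomCoeff q) := by
  simpa using (hasSum_binomCoeff q zero_le_one le_rfl).summable

end Coefficients

/-! ### The variance as a double series -/

section VarianceSeries

variable {q : ℝ}

/-- The terms `1 / (N (N + 1 - 2 q))` at `N = n + 1`, which are the moments of the kernel in the
variance integral. -/
def kernelMoment (q : ℝ) (n : ℕ) : ℝ := 1 / (((n : ℝ) + 1) * (n + 2 - 2 * q))

lemma kernelMoment_nonneg (hq1 : q < 1) (n : ℕ) : 0 ≤ kernelMoment q n := by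
  have : (0 : ℝ) ≤ n + 2 - 2 * q := by linarith [(Nat.cast_nonneg n : (0 : ℝ) ≤ n)]
  unfold kernelMoment
  positivity

/-- A telescoping series with nonnegative terms. -/
lemma hasSum_of_telescope {f v : ℕ → ℝ} {L : ℝ} (hf : ∀ n, 0 ≤ f n)
    (h : ∀ n, f n = v n - v (n + 1)) (hv : Tendsto v atTop (𝓝 L)) : HasSum f (v 0 - L) := by
  rw [hasSum_iff_tendsto_nat_of_nonneg hf]
  have e (n : ℕ) : ∑ k ∈ Finset.range n, f k = v 0 - v n := by
    rw [Finset.sum_congr rfl fun k _ => h k, Finset.sum_range_sub']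
  simp only [e]
  exact hv.const_sub _

section SecondMomentRecursion

-- `a` stands for the second moments `E[W n ^ 2]`, of which only the recursion matters here.

variable {a : ℕ → ℝ} (ha0 : a 0 = 0) (ha : ∀ n, a (n + 1) = (1 + 2 * q / n) * a n + 1)
  (hpos : ∀ n, 0 ≤ a n)
include ha0 ha hpos

/-- The second moments grow at most like `n ^ (1 + max q 0)`, hence slower than `n ^ 2`. -/
lemma secondMoment_growth (hq1 : q < 1) (n : ℕ) :
    a n ≤ (n : ℝ) ^ (1 + max q 0) / (1 - max q 0) := by
  set s := max q 0 with hs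
  have hs0 : 0 ≤ s := le_max_right _ _
  have hs1 : 0 < 1 - s := by
    have : s < 1 := max_lt hq1 one_pos
    linarith
  induction n with
  | zero => rw [ha0]; positivity
  | succ n ih =>
    rcases Nat.eq_zero_or_pos n with rfl | hn
    · rw [ha, ha0, le_div_iff₀ hs1]
      simp
      linarith
    · have hn' : (0 : ℝ) < n := by exact_mod_cast hn
      have h1 : (1 + 2 * q / n) * a n ≤ (1 + 2 * s / n) * ((n : ℝ) ^ (1 + s) / (1 - s)) := by
        refine (mul_le_mul_of_nonneg_right ?_ (hpos n)).trans
          (mul_le_mul_of_nonneg_left ih (by positivity))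
        gcongr
        exact le_max_left _ _
      have h2 : (1 + (1 + s) * (1 / n)) * (n : ℝ) ^ (1 + s) ≤ ((n : ℝ) + 1) ^ (1 + s) := by
        have h3 := one_add_mul_self_le_rpow_one_add (s := 1 / (n : ℝ))
          (by linarith [show (0 : ℝ) ≤ 1 / n by positivity]) (p := 1 + s) (by linarith)
        refine (mul_le_mul_of_nonneg_right h3 (by positivity)).trans_eq ?_
        rw [← Real.mul_rpow (by positivity) (by positivity)]
        congr 1
        field_simp
      have h4 : (n : ℝ) ^ (1 + s) = n * (n : ℝ) ^ s := by
        rw [Real.rpow_add hn', Real.rpow_one]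
      have h5 : 1 ≤ (n : ℝ) ^ s := Real.one_le_rpow (by exact_mod_cast hn) hs0
      rw [ha]
      push_cast
      refine (add_le_add_left h1 1).trans ?_
      rw [le_div_iff₀ hs1]
      refine le_trans ?_ h2
      rw [h4]
      field_simp
      nlinarith

lemma summable_secondMoment_div (hq1 : q < 1) :
    Summable fun k : ℕ => a (k + 1) / ((k : ℝ) + 1) ^ 3 := by
  have hs0 : 0 ≤ max q 0 := le_max_right _ _
  have hs1 : 0 < 1 - max q 0 := by linarith [max_lt hq1 (one_pos (α := ℝ))]
  have h1 : Summable fun k : ℕ => (k : ℝ) ^ (max q 0 - 2) / (1 - max q 0) :=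
    (Real.summable_nat_rpow.2 (by linarith)).div_const _
  refine Summable.of_nonneg_of_le (fun k => ?_) (fun k => ?_) ((summable_nat_add_iff 1).2 h1)
  · exact div_nonneg (hpos _) (by positivity)
  · have h2 := secondMoment_growth ha0 ha hpos hq1 (k + 1)
    have hk : (0 : ℝ) < (k : ℝ) + 1 := by positivity
    push_cast at h2 ⊢
    rw [div_le_iff₀ (by positivity)]
    refine h2.trans_eq ?_
    rw [div_mul_eq_mul_div]
    congr 1
    rw [← Real.rpow_natCast, ← Real.rpow_add hk]
    congr 1
    push_cast
    ring

lemma tendsto_secondMoment_div_sq (hq1 : q < 1) :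
    Tendsto (fun n : ℕ => a n / (n : ℝ) ^ 2) atTop (𝓝 0) := by
  have hs1 : 0 < 1 - max q 0 := by linarith [max_lt hq1 (one_pos (α := ℝ))]
  have h1 : Tendsto (fun n : ℕ => (n : ℝ) ^ (-(1 - max q 0)) / (1 - max q 0)) atTop (𝓝 0) := by
    simpa using ((tendsto_rpow_neg_atTop hs1).comp tendsto_natCast_atTop_atTop).div_const
      (1 - max q 0)
  refine tendsto_of_tendsto_of_tendsto_of_le_of_le' tendsto_const_nhds h1
    (Eventually.of_forall fun n => div_nonneg (hpos n) (by positivity)) ?_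
  filter_upwards [eventually_gt_atTop 0] with n hn
  have hn' : (0 : ℝ) < n := by exact_mod_cast hn
  rw [div_le_iff₀ (by positivity), div_mul_eq_mul_div]
  refine (secondMoment_growth ha0 ha hpos hq1 n).trans_eq ?_
  congr 1
  rw [← Real.rpow_natCast, ← Real.rpow_add hn']
  congr 1
  push_cast
  ring

lemma summable_secondMoment_mul_betaCoeff (hq1 : q < 1) (n : ℕ) :
    Summable fun k : ℕ => a (k + 1) / ((k : ℝ) + 1) * betaCoeff (n + 1) (k + 1) := by
  refine Summable.of_nonneg_of_le (fun k => ?_) (fun k => ?_)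
    (summable_secondMoment_div ha0 ha hpos hq1)
  · exact mul_nonneg (div_nonneg (hpos _) (by positivity)) (betaCoeff_nonneg _ _)
  · have h1 := betaCoeff_le_inv_sq (k := k + 1) (by omega) (n := n + 1) (by omega)
    refine (mul_le_mul_of_nonneg_left h1 (div_nonneg (hpos _) (by positivity))).trans_eq ?_
    push_cast
    field_simp

/-- Summation by parts against the recursion of the second moments. -/
lemma hasSum_secondMoment_mul_betaCoeff_sub (hq1 : q < 1) (n : ℕ) :
    HasSum (fun k : ℕ => a (k + 1) / ((k : ℝ) + 1) * betaCoeff (n + 1) (k + 2))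
      (kernelMoment q n) := by
  have hn : (0 : ℝ) < n + 2 - 2 * q := by linarith [(Nat.cast_nonneg n : (0 : ℝ) ≤ n)]
  let v : ℕ → ℝ := fun k =>
    (betaCoeff n (k + 2) + a (k + 1) * betaCoeff (n + 1) (k + 1)) / (n + 2 - 2 * q)
  have h0 (k : ℕ) : 0 ≤ a (k + 1) / ((k : ℝ) + 1) * betaCoeff (n + 1) (k + 2) :=
    mul_nonneg (div_nonneg (hpos _) (by positivity)) (betaCoeff_nonneg _ _)
  have hstep (k : ℕ) :
      a (k + 1) / ((k : ℝ) + 1) * betaCoeff (n + 1) (k + 2) = v k - v (k + 1) := by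
    have h1 := betaCoeff_succ_right (k := k + 1) (by omega) (n + 1)
    have h2 := betaCoeff_sub (k := k + 2) (by omega) n
    have h3 := ha (k + 1)
    have hk : (0 : ℝ) < (k : ℝ) + 1 := by positivity
    simp only [v]
    rw [← sub_div, eq_div_iff hn.ne', h3]
    push_cast at h1 h2 ⊢
    have h4 : betaCoeff (n + 1) (k + 1)
        = ((k : ℝ) + 1 + (n + 1) + 1) * betaCoeff (n + 1) (k + 2) / (k + 1) := by
      rw [eq_div_iff hk.ne', h1]; ring
    rw [h4]
    rw [show k + 1 + 2 = k + 2 + 1 from rfl, show k + 1 + 1 = k + 2 from rfl]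
    rw [← h2]
    field_simp
    ring
  have hlim : Tendsto v atTop (𝓝 0) := by
    have h1 : Tendsto (fun k => betaCoeff n (k + 2)) atTop (𝓝 0) := by
      have h2 : Tendsto (fun k : ℕ => 1 / (((k + 2 : ℕ)) : ℝ)) atTop (𝓝 0) :=
        (tendsto_add_atTop_iff_nat 2).2 tendsto_one_div_atTop_nhds_zero_nat
      exact squeeze_zero (fun k => betaCoeff_nonneg _ _)
        (fun k => betaCoeff_le_inv (by omega) n) h2
    have h3 : Tendsto (fun k => a (k + 1) * betaCoeff (n + 1) (k + 1)) atTop (𝓝 0) := by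
      have h4 := (tendsto_add_atTop_iff_nat 1).2 (tendsto_secondMoment_div_sq ha0 ha hpos hq1)
      refine squeeze_zero (fun k => mul_nonneg (hpos _) (betaCoeff_nonneg _ _)) (fun k => ?_) h4
      rw [div_eq_mul_one_div]
      exact mul_le_mul_of_nonneg_left (betaCoeff_le_inv_sq (by omega) (by omega)) (hpos _)
    simpa [v] using (h1.add h3).div_const ((n : ℝ) + 2 - 2 * q)
  have h := hasSum_of_telescope h0 hstep hlim
  have e : v 0 - 0 = kernelMoment q n := by
    have h1 := betaCoeff_sub (k := 1) le_rfl n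
    have h2 : a 1 = 1 := by rw [ha 0, ha0]; simp
    simp only [v, kernelMoment, zero_add, h2, one_mul, sub_zero]
    rw [show (2 : ℕ) = 1 + 1 from rfl, ← h1, betaCoeff_one_right, sub_add_cancel, div_div]
  rwa [e] at h

/-- The beta transforms of `a k / k` are the tail sums of `kernelMoment`. -/
theorem hasSum_kernelMoment (hq1 : q < 1) (n : ℕ) :
    HasSum (fun j => kernelMoment q (n + j))
      (∑' k : ℕ, a (k + 1) / ((k : ℝ) + 1) * betaCoeff (n + 1) (k + 1)) := by
  let G : ℕ → ℝ := fun n => ∑' k : ℕ, a (k + 1) / ((k : ℝ) + 1) * betaCoeff (n + 1) (k + 1)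
  have hsum := summable_secondMoment_mul_betaCoeff ha0 ha hpos hq1
  have hG (n : ℕ) : kernelMoment q n = G n - G (n + 1) := by
    rw [← (hasSum_secondMoment_mul_betaCoeff_sub ha0 ha hpos hq1 n).tsum_eq,
      ← (hsum n).tsum_sub (hsum (n + 1))]
    refine tsum_congr fun k => ?_
    rw [← mul_sub, betaCoeff_sub (by omega)]
  have hlim : Tendsto G atTop (𝓝 0) := by
    have h := tendsto_tsum_of_dominated_convergence (𝓕 := atTop)
      (f := fun n k => a (k + 1) / ((k : ℝ) + 1) * betaCoeff (n + 1) (k + 1)) (g := fun _ => (0 : ℝ))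
      (hsum 0) (fun k => ?_) (Eventually.of_forall fun n k => ?_)
    · simpa using h
    · have h1 : Tendsto (fun n => betaCoeff (n + 1) (k + 1)) atTop (𝓝 0) := by
        refine squeeze_zero (fun n => betaCoeff_nonneg _ _)
          (fun n => betaCoeff_le (by omega) (n + 1)) ?_
        simpa using (tendsto_add_atTop_iff_nat 1).2
          (tendsto_one_div_add_atTop_nhds_zero_nat (𝕜 := ℝ))
      simpa using h1.const_mul (a (k + 1) / ((k : ℝ) + 1))
    · have h0 : 0 ≤ a (k + 1) / ((k : ℝ) + 1) := div_nonneg (hpos _) (by positivity)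
      rw [Real.norm_of_nonneg (mul_nonneg h0 (betaCoeff_nonneg _ _))]
      exact mul_le_mul_of_nonneg_left (betaCoeff_antitone (by omega) (by omega)) h0
  have h := hasSum_of_telescope (f := fun j => kernelMoment q (n + j)) (v := fun j => G (n + j))
    (fun j => kernelMoment_nonneg hq1 _) (fun j => hG _)
    (by simpa [add_comm] using (tendsto_add_atTop_iff_nat n).2 hlim)
  simpa using h

/-- The variance series, rearranged as a double series with nonnegative terms. -/
theorem exists_hasSum_variance (hq0 : -1 ≤ q) (hq1 : q < 1) :
    ∃ S : ℝ, HasSum (fun k : ℕ => a (k + 1) / ((k : ℝ) + 1)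
        * (2 * dualCoeff q (k + 1) - 1 / (k + 1 : ℕ))) S ∧
      HasSum (fun x : ℕ × ℕ => binomCoeff q (x.1 + 1) * kernelMoment q (x.1 + x.2)) S := by
  have hb (k : ℕ) : 0 ≤ a (k + 1) / ((k : ℝ) + 1) := div_nonneg (hpos _) (by positivity)
  have hw := binomCoeff_nonneg hq1.le
  let G : ℕ → ℝ := fun n => ∑' k : ℕ, a (k + 1) / ((k : ℝ) + 1) * betaCoeff (n + 1) (k + 1)
  have hsum := summable_secondMoment_mul_betaCoeff ha0 ha hpos hq1
  have hG0 (n : ℕ) : G n ≤ G 0 := by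
    refine (hsum n).tsum_le_tsum (fun k => ?_) (hsum 0)
    exact mul_le_mul_of_nonneg_left (betaCoeff_antitone (by omega) (by omega)) (hb k)
  have hGnn (n : ℕ) : 0 ≤ G n := tsum_nonneg fun k => mul_nonneg (hb k) (betaCoeff_nonneg _ _)
  have hwG : Summable fun n => binomCoeff q (n + 1) * G n := by
    refine Summable.of_nonneg_of_le (fun n => mul_nonneg (hw _) (hGnn n))
      (fun n => mul_le_mul_of_nonneg_left (hG0 n) (hw _))
      (((summable_nat_add_iff 1).2 (summable_binomCoeff q)).mul_right (G 0))
  refine ⟨∑' n, binomCoeff q (n + 1) * G n, ?_, ?_⟩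
  · let F : ℕ × ℕ → ℝ := fun x =>
      binomCoeff q (x.1 + 1) * (a (x.2 + 1) / ((x.2 : ℝ) + 1) * betaCoeff (x.1 + 1) (x.2 + 1))
    have hF0 : 0 ≤ F := fun x => mul_nonneg (hw _) (mul_nonneg (hb _) (betaCoeff_nonneg _ _))
    have hFsum (n : ℕ) : HasSum (fun k => F (n, k)) (binomCoeff q (n + 1) * G n) :=
      (hsum n).hasSum.mul_left _
    have hF : Summable F := by
      rw [summable_prod_of_nonneg hF0]
      exact ⟨fun n => (hFsum n).summable, by simpa only [(hFsum _).tsum_eq] using hwG⟩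
    have h1 : HasSum F (∑' n, binomCoeff q (n + 1) * G n) := by
      have h2 := hF.hasSum.prod_fiberwise hFsum
      rw [h2.tsum_eq]
      exact hF.hasSum
    have h3 := (Equiv.prodComm ℕ ℕ).hasSum_iff.2 h1
    refine h3.prod_fiberwise fun k => ?_
    have h4 := (hasSum_two_mul_dualCoeff_sub hq0 hq1.le (k := k + 1) (by omega)).mul_left
      (a (k + 1) / ((k : ℝ) + 1))
    refine hasSum_of_forall_eq h4 fun n => ?_
    rw [← binomCoeff_mul_betaCoeff]
    simp only [F, Function.comp_apply, Equiv.prodComm_apply, Prod.swap]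
    ring
  · let F : ℕ × ℕ → ℝ := fun x => binomCoeff q (x.1 + 1) * kernelMoment q (x.1 + x.2)
    have hF0 : 0 ≤ F := fun x => mul_nonneg (hw _) (kernelMoment_nonneg hq1 _)
    have hFsum (n : ℕ) : HasSum (fun k => F (n, k)) (binomCoeff q (n + 1) * G n) :=
      (hasSum_kernelMoment ha0 ha hpos hq1 n).mul_left _
    have hF : Summable F := by
      rw [summable_prod_of_nonneg hF0]
      exact ⟨fun n => (hFsum n).summable, by simpa only [(hFsum _).tsum_eq] using hwG⟩
    have h2 := hF.hasSum.prod_fiberwise hFsum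
    rw [h2.tsum_eq]
    exact hF.hasSum

end SecondMomentRecursion

end VarianceSeries

/-! ### The variance integral -/

section VarianceIntegral

/-- Term-by-term integration of a series of nonnegative functions. -/
lemma integrable_and_integral_eq_of_hasSum {α ι : Type*} [Countable ι] {mα : MeasurableSpace α}
    {ν : Measure α} {F : ι → α → ℝ} {f : α → ℝ} {S : ℝ} (hF : ∀ i, Integrable (F i) ν)
    (hF0 : ∀ i, ∀ᵐ x ∂ν, 0 ≤ F i x) (hf : ∀ᵐ x ∂ν, HasSum (fun i => F i x) (f x))
    (hS : HasSum (fun i => ∫ x, F i x ∂ν) S) : Integrable f ν ∧ ∫ x, f x ∂ν = S := by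
  have hall : ∀ᵐ x ∂ν, ∀ i, 0 ≤ F i x := ae_all_iff.2 hF0
  have hf0 : 0 ≤ᵐ[ν] f := by
    filter_upwards [hall, hf] with x h1 h2
    exact h2.nonneg h1
  have hS0 : 0 ≤ S := hS.nonneg fun i => integral_nonneg_of_ae (hF0 i)
  have hof : ∀ᵐ x ∂ν, ENNReal.ofReal (f x) = ∑' i, ENNReal.ofReal (F i x) := by
    filter_upwards [hall, hf] with x h1 h2
    rw [← h2.tsum_eq, ENNReal.ofReal_tsum_of_nonneg h1 h2.summable]
  have hmeas : AEMeasurable f ν := by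
    have h1 : AEMeasurable (fun x => (∑' i, ENNReal.ofReal (F i x)).toReal) ν :=
      (AEMeasurable.tsum fun i => (hF i).1.aemeasurable.ennreal_ofReal).ennreal_toReal
    refine h1.congr ?_
    filter_upwards [hof, hf0] with x h2 h3
    rw [← h2, ENNReal.toReal_ofReal h3]
  have hlint : ∫⁻ x, ENNReal.ofReal (f x) ∂ν = ENNReal.ofReal S := by
    rw [lintegral_congr_ae hof,
      lintegral_tsum fun i => (hF i).1.aemeasurable.ennreal_ofReal, ← hS.tsum_eq,
      ENNReal.ofReal_tsum_of_nonneg (fun i => integral_nonneg_of_ae (hF0 i)) hS.summable]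
    exact tsum_congr fun i => (ofReal_integral_eq_lintegral_ofReal (hF i) (hF0 i)).symm
  refine ⟨⟨hmeas.aestronglyMeasurable, ?_⟩, ?_⟩
  · rw [hasFiniteIntegral_iff_ofReal hf0, hlint]
    exact ENNReal.ofReal_lt_top
  · rw [integral_eq_lintegral_of_nonneg_ae hf0 hmeas.aestronglyMeasurable, hlint,
      ENNReal.toReal_ofReal hS0]

variable {q : ℝ}

/-- The function `(u ^ (1 - 2 q) - 1) / (2 q - 1) = ∫_u^1 t ^ (-2 q) dt`. At `q = 1 / 2` this
integral is `-log u`. -/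
def varianceKernel (q u : ℝ) : ℝ :=
  if q = 1 / 2 then -Real.log u else (u ^ (-2 * q + 1) - 1) / (2 * q - 1)

lemma varianceKernel_nonneg (q : ℝ) {u : ℝ} (hu0 : 0 < u) (hu1 : u ≤ 1) :
    0 ≤ varianceKernel q u := by
  unfold varianceKernel
  split_ifs with h
  · linarith [Real.log_nonpos hu0.le hu1]
  · rcases lt_or_gt_of_ne h with h | h
    · refine div_nonneg_of_nonpos ?_ (by linarith)
      linarith [Real.rpow_le_one hu0.le hu1 (by linarith : 0 ≤ -2 * q + 1)]
    · refine div_nonneg ?_ (by linarith)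
      linarith [Real.one_le_rpow_of_pos_of_le_one_of_nonpos hu0 hu1
        (by linarith : -2 * q + 1 ≤ 0)]

lemma intervalIntegrable_log_mul_pow (n : ℕ) :
    IntervalIntegrable (fun u : ℝ => -Real.log u * u ^ n) volume 0 1 :=
  intervalIntegral.intervalIntegrable_log'.neg.mul_continuousOn (continuous_pow n).continuousOn

lemma integral_log_mul_pow (n : ℕ) :
    ∫ u in (0 : ℝ)..1, -Real.log u * u ^ n = 1 / ((n : ℝ) + 1) ^ 2 := by
  have hn : (n : ℝ) + 1 ≠ 0 := by positivity
  let F : ℝ → ℝ := fun u => -(u * Real.log u) * u ^ n / (n + 1) + u ^ (n + 1) / ((n : ℝ) + 1) ^ 2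
  have hF : Continuous F :=
    (((Real.continuous_mul_log.neg).mul (continuous_pow n)).div_const _).add
      ((continuous_pow (n + 1)).div_const _)
  have hderiv : ∀ u ∈ Set.Ioo (0 : ℝ) 1, HasDerivAt F (-Real.log u * u ^ n) u := by
    intro u hu
    have h1 := (((Real.hasDerivAt_mul_log hu.1.ne').neg.mul (hasDerivAt_pow n u)).div_const
      ((n : ℝ) + 1)).add ((hasDerivAt_pow (n + 1) u).div_const (((n : ℝ) + 1) ^ 2))
    refine HasDerivAt.congr_deriv (f := F) h1 ?_
    have h2 : u * (n * u ^ (n - 1)) = n * u ^ n := by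
      cases n with
      | zero => simp
      | succ n => rw [Nat.add_sub_cancel, pow_succ]; ring
    simp only [Pi.neg_apply, Nat.add_sub_cancel]
    push_cast
    rw [show -(u * Real.log u) * (n * u ^ (n - 1)) = -Real.log u * (u * (n * u ^ (n - 1))) by ring,
      h2]
    field_simp
    ring
  rw [intervalIntegral.integral_eq_sub_of_hasDerivAt_of_le zero_le_one hF.continuousOn hderiv
    (intervalIntegrable_log_mul_pow n)]
  simp [F]

lemma intervalIntegrable_varianceKernel_mul_pow (hq1 : q < 1) (n : ℕ) :
    IntervalIntegrable (fun u => varianceKernel q u * u ^ n) volume 0 1 := by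
  unfold varianceKernel
  split_ifs with h
  · exact intervalIntegrable_log_mul_pow n
  · refine IntervalIntegrable.mul_continuousOn ?_ (continuous_pow n).continuousOn
    exact ((intervalIntegral.intervalIntegrable_rpow' (by linarith)).sub
      intervalIntegrable_const).div_const _

/-- The moments of the variance kernel. -/
lemma integral_varianceKernel_mul_pow (hq1 : q < 1) (n : ℕ) :
    ∫ u in (0 : ℝ)..1, varianceKernel q u * u ^ n = kernelMoment q n := by
  have hn : (n : ℝ) + 1 ≠ 0 := by positivity
  have hn2 : (n : ℝ) + 2 - 2 * q ≠ 0 := by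
    have := (Nat.cast_nonneg n : (0 : ℝ) ≤ n)
    intro h
    linarith
  unfold varianceKernel kernelMoment
  split_ifs with h
  · rw [integral_log_mul_pow, h]
    congr 1
    ring
  · have h2 : 2 * q - 1 ≠ 0 := fun h' => h (by linarith)
    have hexp : -1 < -2 * q + 1 + n := by linarith [(Nat.cast_nonneg n : (0 : ℝ) ≤ n)]
    have e : ∫ u in (0 : ℝ)..1, (u ^ (-2 * q + 1) - 1) / (2 * q - 1) * u ^ n
        = ∫ u in (0 : ℝ)..1, (u ^ (-2 * q + 1 + n) - u ^ n) / (2 * q - 1) := by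
      refine intervalIntegral.integral_congr_uIoo fun u hu => ?_
      rw [Set.uIoo_of_le zero_le_one] at hu
      have h3 : u ^ (-2 * q + 1 + n) = u ^ (-2 * q + 1) * u ^ n := by
        rw [Real.rpow_add hu.1, Real.rpow_natCast]
      rw [h3]
      ring
    rw [e, intervalIntegral.integral_div, intervalIntegral.integral_sub
      (intervalIntegral.intervalIntegrable_rpow' hexp) (by simp), integral_rpow (Or.inl hexp),
      integral_pow, Real.one_rpow, Real.zero_rpow (by linarith)]
    have h3 : -2 * q + 1 + n + 1 ≠ 0 := by
      intro h'; apply hn2; linarith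
    have h4 : -2 * q + 1 + (n : ℝ) + 1 = n + 2 - 2 * q := by ring
    rw [h4]
    simp
    field_simp
    ring

lemma hasSum_variance_integrand (hq1 : q < 1) {u : ℝ} (hu : u ∈ Set.Ioo (0 : ℝ) 1) :
    HasSum (fun x : ℕ × ℕ => binomCoeff q (x.1 + 1) * (varianceKernel q u * u ^ (x.1 + x.2)))
      (varianceKernel q u / (1 - u) * (((1 - u / 2) ^ (q - 1) - 1) / u)) := by
  have hu0 := hu.1
  have h1 : HasSum (fun n => binomCoeff q (n + 1) * u ^ n) (((1 - u / 2) ^ (q - 1) - 1) / u) := by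
    have h2 := (hasSum_nat_add_iff' 1).2 (hasSum_binomCoeff q hu.1.le hu.2.le)
    have h3 := h2.div_const u
    simp only [Finset.sum_range_one, pow_zero, mul_one] at h3
    have h4 : binomCoeff q 0 = 1 := by simp [binomCoeff]
    rw [h4] at h3
    refine hasSum_of_forall_eq h3 fun n => ?_
    rw [pow_succ]
    field_simp
  have h2 := hasSum_geometric_of_lt_one hu.1.le hu.2
  have h3 := h1.mul h2 (h1.summable.mul_of_nonneg h2.summable
    (fun n => mul_nonneg (binomCoeff_nonneg hq1.le _) (pow_nonneg hu.1.le _))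
    (fun n => pow_nonneg hu.1.le _))
  have h4 := h3.mul_left (varianceKernel q u)
  have e1 : (fun x : ℕ × ℕ => binomCoeff q (x.1 + 1) * (varianceKernel q u * u ^ (x.1 + x.2)))
      = fun x : ℕ × ℕ => varianceKernel q u * (binomCoeff q (x.1 + 1) * u ^ x.1 * u ^ x.2) := by
    ext x
    rw [pow_add]
    ring
  have e2 : varianceKernel q u / (1 - u) * (((1 - u / 2) ^ (q - 1) - 1) / u)
      = varianceKernel q u * (((1 - u / 2) ^ (q - 1) - 1) / u * (1 - u)⁻¹) := by
    ring
  rw [e1, e2]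
  exact h4

/-- The double series for the variance, summed under the integral sign. The interval integral is
treated over the open interval, where the geometric series in `u` converges. -/
theorem variance_integral (hq1 : q < 1) {S : ℝ}
    (hS : HasSum (fun x : ℕ × ℕ => binomCoeff q (x.1 + 1) * kernelMoment q (x.1 + x.2)) S) :
    IntervalIntegrable (fun u => varianceKernel q u / (1 - u) * (((1 - u / 2) ^ (q - 1) - 1) / u))
      volume 0 1 ∧
    ∫ u in (0 : ℝ)..1, varianceKernel q u / (1 - u) * (((1 - u / 2) ^ (q - 1) - 1) / u) = S := by
  have hmem : ∀ᵐ u ∂(volume.restrict (Set.Ioo (0 : ℝ) 1)), u ∈ Set.Ioo (0 : ℝ) 1 :=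
    ae_restrict_mem measurableSet_Ioo
  have hI (n : ℕ) : Integrable (fun u => varianceKernel q u * u ^ n)
      (volume.restrict (Set.Ioo (0 : ℝ) 1)) :=
    ((intervalIntegrable_iff_integrableOn_Ioo_of_le zero_le_one).1
      (intervalIntegrable_varianceKernel_mul_pow hq1 n))
  have key := integrable_and_integral_eq_of_hasSum
    (ν := volume.restrict (Set.Ioo (0 : ℝ) 1)) (ι := ℕ × ℕ)
    (F := fun x u => binomCoeff q (x.1 + 1) * (varianceKernel q u * u ^ (x.1 + x.2)))
    (fun x => (hI _).const_mul _)
    (fun x => by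
      filter_upwards [hmem] with u hu
      exact mul_nonneg (binomCoeff_nonneg hq1.le _)
        (mul_nonneg (varianceKernel_nonneg q hu.1 hu.2.le) (pow_nonneg hu.1.le _)))
    (by
      filter_upwards [hmem] with u hu
      exact hasSum_variance_integrand hq1 hu)
    (S := S) (by
      have e (x : ℕ × ℕ) : ∫ u in Set.Ioo (0 : ℝ) 1,
          binomCoeff q (x.1 + 1) * (varianceKernel q u * u ^ (x.1 + x.2))
            = binomCoeff q (x.1 + 1) * kernelMoment q (x.1 + x.2) := by
        rw [integral_const_mul, ← integral_Ioc_eq_integral_Ioo,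
          ← intervalIntegral.integral_of_le zero_le_one, integral_varianceKernel_mul_pow hq1]
      simp only [e]
      exact hS)
  refine ⟨(intervalIntegrable_iff_integrableOn_Ioo_of_le zero_le_one).2 key.1, ?_⟩
  rw [intervalIntegral.integral_of_le zero_le_one, integral_Ioc_eq_integral_Ioo]
  exact key.2

end VarianceIntegral

/-! ### The law of large numbers -/

/-- A sequence that is contracted by factors `1 - δ / (n + 1)` and perturbed by the increments of
a convergent sequence tends to `0`, because the harmonic series diverges. -/
lemma tendsto_zero_of_contraction {δ L : ℝ} (hδ : 0 < δ) {x U : ℕ → ℝ}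
    (hU : Tendsto U atTop (𝓝 L))
    (hx : ∀ n : ℕ, x (n + 1) = (1 - δ / (n + 1)) * x n + (U (n + 1) - U n)) :
    Tendsto x atTop (𝓝 0) := by
  have hε : Tendsto (fun n => U n - L) atTop (𝓝 0) := by simpa using hU.sub_const L
  set z : ℕ → ℝ := fun n => x n - (U n - L) with hz
  have hzrec (n : ℕ) : z (n + 1) = (1 - δ / (n + 1)) * z n - δ / (n + 1) * (U n - L) := by
    simp only [hz]
    rw [hx]
    ring
  have hδn : Tendsto (fun n : ℕ => δ / ((n : ℝ) + 1)) atTop (𝓝 0) := by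
    simpa [div_eq_mul_inv] using
      (tendsto_one_div_add_atTop_nhds_zero_nat (𝕜 := ℝ)).const_mul δ
  have hz0 : Tendsto z atTop (𝓝 0) := by
    rw [Metric.tendsto_atTop]
    intro η hη
    obtain ⟨N, hN⟩ := eventually_atTop.1
      ((hδn.eventually (gt_mem_nhds one_pos)).and
        ((tendsto_zero_iff_abs_tendsto_zero _).1 hε |>.eventually (gt_mem_nhds (half_pos hη))))
    let E : ℕ → ℝ := fun n => Real.exp (-∑ k ∈ Finset.Ico N n, δ / ((k : ℝ) + 1))
    have hbound : ∀ n, N ≤ n → |z n| ≤ η / 2 + |z N| * E n := by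
      intro n hn
      induction n, hn using Nat.le_induction with
      | base => simp [E]; linarith
      | succ n hn ih =>
        obtain ⟨h1, h2⟩ := hN n hn
        simp only [Function.comp_apply] at h2
        have h0 : 0 ≤ δ / ((n : ℝ) + 1) := by positivity
        have h3 : |z (n + 1)| ≤ (1 - δ / (n + 1)) * |z n| + δ / (n + 1) * (η / 2) := by
          rw [hzrec]
          refine (abs_sub _ _).trans ?_
          rw [abs_mul, abs_mul, abs_of_nonneg (by linarith : 0 ≤ 1 - δ / ((n : ℝ) + 1)),
            abs_of_nonneg h0]
          gcongr
        have h4 : E (n + 1) = E n * Real.exp (-(δ / ((n : ℝ) + 1))) := by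
          simp only [E]
          rw [Finset.sum_Ico_succ_top hn, neg_add, Real.exp_add]
        have h5 : 1 - δ / ((n : ℝ) + 1) ≤ Real.exp (-(δ / ((n : ℝ) + 1))) :=
          Real.one_sub_le_exp_neg _
        have h6 : 0 ≤ |z N| * E n := mul_nonneg (abs_nonneg _) (Real.exp_nonneg _)
        calc |z (n + 1)| ≤ (1 - δ / (n + 1)) * (η / 2 + |z N| * E n) + δ / (n + 1) * (η / 2) :=
              h3.trans (by gcongr)
          _ = η / 2 + |z N| * E n * (1 - δ / (n + 1)) := by ring
          _ ≤ η / 2 + |z N| * E n * Real.exp (-(δ / ((n : ℝ) + 1))) := by gcongr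
          _ = η / 2 + |z N| * E (n + 1) := by rw [h4]; ring
    have hE : Tendsto (fun n => |z N| * E n) atTop (𝓝 0) := by
      have h1 : Tendsto (fun n => ∑ k ∈ Finset.range n, δ / ((k : ℝ) + 1)) atTop atTop := by
        have := Real.tendsto_sum_range_one_div_nat_succ_atTop.const_mul_atTop hδ
        simpa [Finset.mul_sum, div_eq_mul_inv] using this
      have h2 : Tendsto (fun n => ∑ k ∈ Finset.Ico N n, δ / ((k : ℝ) + 1)) atTop atTop := by
        refine (tendsto_atTop_add_const_right atTop
          (-∑ k ∈ Finset.range N, δ / ((k : ℝ) + 1)) h1).congr' ?_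
        filter_upwards [eventually_ge_atTop N] with n hn
        rw [Finset.sum_Ico_eq_sub _ hn, sub_eq_add_neg]
      simpa using (Real.tendsto_exp_neg_atTop_nhds_zero.comp h2).const_mul |z N|
    obtain ⟨N', hN'⟩ := eventually_atTop.1 (hE.eventually (gt_mem_nhds (half_pos hη)))
    refine ⟨max N N', fun n hn => ?_⟩
    have h1 := hbound n (le_of_max_le_left hn)
    have h2 := hN' n (le_of_max_le_right hn)
    rw [Real.dist_eq, sub_zero]
    linarith
  have := hz0.add hε
  simpa [hz] using this

section LimitTheorems

variable {Ω : Type*} {m : MeasurableSpace Ω} {μ : Measure Ω} [IsProbabilityMeasure μ] {p q : ℝ}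
  {g : ℕ → Ω → Letter} {I : ℕ → Ω → ℕ} {c : ℕ → Ω → Bool}

/-- The law of large numbers for the elephant random walk on the integers. -/
theorem IsElephantSteps.tendsto_meanStep (h : IsElephantSteps p μ g I c) (hq : q = 2 * p - 1)
    (hq0 : -1 ≤ q) (hq1 : q < 1) :
    ∀ᵐ ω ∂μ, Tendsto (fun n => meanStep g n ω) atTop (𝓝 0) := by
  have hξ := h.isBoundedMartingaleDiff hq (abs_le.2 ⟨hq0, hq1.le⟩)
  have hd : Summable fun k : ℕ => (1 / ((k : ℝ) + 1)) ^ 2 := by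
    simpa using (summable_nat_add_iff 1).2 (Real.summable_one_div_nat_pow.2 one_lt_two)
  obtain ⟨U, -, hU, -⟩ := hξ.exists_tendsto_transform hd
  filter_upwards [hU] with ω hω
  refine tendsto_zero_of_contraction (δ := 1 - q) (by linarith) hω fun n => ?_
  have hn : (n : ℝ) + 1 ≠ 0 := by positivity
  have e : transform (fun k : ℕ => 1 / ((k : ℝ) + 1)) (innovation q g) (n + 1) ω
      - transform (fun k : ℕ => 1 / ((k : ℝ) + 1)) (innovation q g) n ω
      = 1 / ((n : ℝ) + 1) * innovation q g n ω := by
    simp [transform, Finset.sum_range_succ]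
  rw [e, innovation, meanStep, elephantZ_succ, elephantZ_eq_mul_meanStep]
  push_cast
  field_simp
  ring

/-! ### The limit of the predictable part -/

/-- The weights of the martingale that converges to `∑ₖ (-1) ^ k * W k / k`. -/
def limitWeight (q : ℝ) (k : ℕ) : ℝ := (-1) ^ (k + 1) * dualCoeff q (k + 1)

lemma limitWeight_sq (q : ℝ) (k : ℕ) : limitWeight q k ^ 2 = dualCoeff q (k + 1) ^ 2 := by
  rw [limitWeight, mul_pow, ← pow_mul, mul_comm (k + 1) 2, pow_mul]
  simp

lemma summable_limitWeight_sq (hq0 : -1 ≤ q) (hq1 : q < 1) :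
    Summable fun k => limitWeight q k ^ 2 := by
  simp only [limitWeight_sq]
  have h1 := (summable_nat_add_iff 1).2 (Real.summable_one_div_nat_pow.2 one_lt_two)
  refine Summable.of_nonneg_of_le (fun k => sq_nonneg _) (fun k => ?_) h1
  rw [← one_div_pow]
  exact pow_le_pow_left₀ (dualCoeff_nonneg hq1.le _) (dualCoeff_le hq0 hq1.le (by omega)) 2

/-- Adding the term `(-1) ^ n * e n * W n` turns the alternating sums into a martingale. -/
lemma transform_limitWeight (hq0 : -1 ≤ q) (hq1 : q < 1) (g : ℕ → Ω → Letter) (n : ℕ) (ω : Ω) :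
    transform (limitWeight q) (innovation q g) n ω
      = alternatingSum g n ω + (-1) ^ n * dualCoeff q n * elephantZ g n ω := by
  induction n with
  | zero => simp [transform, alternatingSum, elephantZ_zero]
  | succ n ih =>
    have hT : transform (limitWeight q) (innovation q g) (n + 1) ω
        = transform (limitWeight q) (innovation q g) n ω + limitWeight q n * innovation q g n ω := by
      simp [transform, Finset.sum_range_succ]
    have hA : alternatingSum g (n + 1) ω = alternatingSum g n ω + (-1) ^ n * meanStep g n ω := by
      simp only [alternatingSum_eq_sum_range, Finset.sum_range_succ]
    have key : dualCoeff q (n + 1) * (n + q) * meanStep g n ω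
        = (1 - n * dualCoeff q n) * meanStep g n ω := by
      rcases Nat.eq_zero_or_pos n with rfl | hn
      · simp [meanStep_zero]
      · rw [← dualCoeff_recursion hq0 hq1.le hn]; ring
    rw [hT, ih, hA, elephantZ_succ, elephantZ_eq_mul_meanStep, limitWeight, innovation, pow_succ]
    linear_combination (-1 : ℝ) ^ n * key

/-- The second moment of the limit martingale, up to a term that tends to `0`, is a partial sum of
the variance series. -/
lemma IsElephantSteps.integral_transform_limitWeight_sq (h : IsElephantSteps p μ g I c)
    (hq : q = 2 * p - 1) (hq0 : -1 ≤ q) (hq1 : q < 1) (n : ℕ) :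
    ∫ ω, transform (limitWeight q) (innovation q g) (n + 1) ω ^ 2 ∂μ
      = ∑ k ∈ Finset.range n, secondMoment μ g (k + 1) / ((k : ℝ) + 1)
          * (2 * dualCoeff q (k + 1) - 1 / (k + 1 : ℕ))
        + dualCoeff q (n + 1) ^ 2 * secondMoment μ g (n + 1) := by
  have hξ := h.isBoundedMartingaleDiff hq (abs_le.2 ⟨hq0, hq1.le⟩)
  rw [hξ.integral_transform_sq]
  simp only [h.integral_innovation_sq hq, limitWeight_sq]
  induction n with
  | zero => simp [h.secondMoment_succ hq, secondMoment_zero]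
  | succ n ih =>
    rw [Finset.sum_range_succ, ih, Finset.sum_range_succ, h.secondMoment_succ hq (n + 1)]
    have h1 := dualCoeff_recursion hq0 hq1.le (k := n + 1) (by omega)
    have hn : (n : ℝ) + 1 ≠ 0 := by positivity
    have h2 : dualCoeff q (n + 1) = (1 - (n + 1 + q) * dualCoeff q (n + 1 + 1)) / (n + 1) := by
      rw [eq_div_iff hn]
      push_cast at h1
      linarith
    rw [h2]
    push_cast
    field_simp
    ring_nf

/-- The limit of the alternating sums. Its second moment is given as the sum of a double series,
which `variance_integral` turns into an integral. -/
theorem IsElephantSteps.exists_limit (h : IsElephantSteps p μ g I c) (hq : q = 2 * p - 1)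
    (hq0 : -1 ≤ q) (hq1 : q < 1) :
    ∃ Y : Ω → ℝ, MemLp Y 2 μ ∧
      (∀ᵐ ω ∂μ, Tendsto (fun n => alternatingSum g n ω) atTop (𝓝 (Y ω))) ∧
      Tendsto (fun n => eLpNorm (fun ω => alternatingSum g n ω - Y ω) 2 μ) atTop (𝓝 0) ∧
      ∫ ω, Y ω ∂μ = 0 ∧
      HasSum (fun x : ℕ × ℕ => binomCoeff q (x.1 + 1) * kernelMoment q (x.1 + x.2))
        (∫ ω, Y ω ^ 2 ∂μ) := by
  have hξ := h.isBoundedMartingaleDiff hq (abs_le.2 ⟨hq0, hq1.le⟩)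
  obtain ⟨Y, hY, hae, hL2⟩ := hξ.exists_tendsto_transform (summable_limitWeight_sq hq0 hq1)
  set M := transform (limitWeight q) (innovation q g) with hM
  have ha0 : secondMoment μ g 0 = 0 := secondMoment_zero
  have hrec := h.secondMoment_succ hq
  have hsq : Tendsto (fun n => secondMoment μ g n / (n : ℝ) ^ 2) atTop (𝓝 0) :=
    tendsto_secondMoment_div_sq ha0 hrec secondMoment_nonneg hq1
  have halt (n : ℕ) (ω : Ω) :
      alternatingSum g n ω = M n ω - (-1) ^ n * dualCoeff q n * elephantZ g n ω := by
    rw [hM, transform_limitWeight hq0 hq1]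
    ring
  have he (n : ℕ) : dualCoeff q n ≤ 1 / n := by
    rcases Nat.eq_zero_or_pos n with rfl | hn
    · simp [dualCoeff]
    · exact dualCoeff_le hq0 hq1.le hn
  -- The correction term is negligible almost surely and in `L²`.
  have hae0 : ∀ᵐ ω ∂μ, Tendsto (fun n => (-1) ^ n * dualCoeff q n * (elephantZ g n ω : ℝ))
      atTop (𝓝 0) := by
    filter_upwards [h.tendsto_meanStep hq hq0 hq1] with ω hω
    refine squeeze_zero_norm (fun n => ?_) (tendsto_zero_iff_norm_tendsto_zero.1 hω)
    rw [norm_mul, norm_mul, norm_pow, norm_neg, norm_one, one_pow, one_mul, meanStep, norm_div,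
      Real.norm_of_nonneg (dualCoeff_nonneg hq1.le n), Real.norm_natCast, div_eq_mul_one_div,
      mul_comm]
    exact mul_le_mul_of_nonneg_left (he n) (norm_nonneg _)
  have hcorr (n : ℕ) : dualCoeff q n ^ 2 * secondMoment μ g n ≤ secondMoment μ g n / (n : ℝ) ^ 2 := by
    rw [div_eq_mul_one_div, mul_comm, ← one_div_pow]
    exact mul_le_mul_of_nonneg_left (pow_le_pow_left₀ (dualCoeff_nonneg hq1.le n) (he n) 2)
      (secondMoment_nonneg n)
  have hcorr0 : Tendsto (fun n => dualCoeff q n ^ 2 * secondMoment μ g n) atTop (𝓝 0) :=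
    squeeze_zero (fun n => mul_nonneg (sq_nonneg _) (secondMoment_nonneg n)) hcorr hsq
  have hmem (n : ℕ) : MemLp (fun ω => (-1) ^ n * dualCoeff q n * (elephantZ g n ω : ℝ)) 2 μ :=
    (memLp_elephantZ h.measurable_step n).const_mul _
  have hL20 : Tendsto (fun n => eLpNorm (fun ω => (-1) ^ n * dualCoeff q n * (elephantZ g n ω : ℝ))
      2 μ) atTop (𝓝 0) := by
    have e (n : ℕ) : eLpNorm (fun ω => (-1) ^ n * dualCoeff q n * (elephantZ g n ω : ℝ)) 2 μ
        = ENNReal.ofReal (√(dualCoeff q n ^ 2 * secondMoment μ g n)) := by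
      rw [eLpNorm_two_eq (hmem n), secondMoment, ← integral_const_mul]
      congr 3
      ext ω
      rw [mul_pow, mul_pow, ← pow_mul, mul_comm n 2, pow_mul]
      simp
    simp only [e]
    simpa using ENNReal.tendsto_ofReal ((Real.continuous_sqrt.tendsto _).comp hcorr0)
  refine ⟨Y, hY, ?_, ?_, ?_, ?_⟩
  · filter_upwards [hae, hae0] with ω h1 h2
    simpa [halt] using h1.sub h2
  · have hsum := hL2.add hL20
    rw [add_zero] at hsum
    refine tendsto_of_tendsto_of_tendsto_of_le_of_le tendsto_const_nhds hsum
      (fun _ => zero_le) fun n => ?_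
    have e : (fun ω => alternatingSum g n ω - Y ω) = (fun ω => M n ω - Y ω)
        - fun ω => (-1) ^ n * dualCoeff q n * (elephantZ g n ω : ℝ) := by
      ext ω
      rw [Pi.sub_apply, halt]
      ring
    rw [e]
    exact eLpNorm_sub_le ((hξ.memLp_transform _ n).1.sub hY.1) (hmem n).1 one_le_two
  · have h1 := tendsto_integral_of_tendsto_eLpNorm_two (fun n => hξ.memLp_transform _ n) hY hL2
    simp only [hξ.integral_transform] at h1
    exact tendsto_nhds_unique h1 tendsto_const_nhds
  · obtain ⟨S, hS1, hS2⟩ := exists_hasSum_variance ha0 hrec secondMoment_nonneg hq0 hq1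
    have h1 := tendsto_integral_sq_of_tendsto_eLpNorm (fun n => hξ.memLp_transform _ n) hY hL2
    have h2 := (tendsto_add_atTop_iff_nat 1).2 h1
    simp only [h.integral_transform_limitWeight_sq hq hq0 hq1] at h2
    have h3 := hS1.tendsto_sum_nat.add ((tendsto_add_atTop_iff_nat 1).2 hcorr0)
    rw [add_zero] at h3
    rw [tendsto_nhds_unique h2 h3]
    exact hS2

end LimitTheorems

end DihedralERW

end

theorem theorem1 {Ω : Type*} {m : MeasurableSpace Ω} (μ : Measure Ω) [IsProbabilityMeasure μ]
    (p q : ℝ) (hp0 : 0 ≤ p) (hp1 : p < 1) (hq : q = 2 * p - 1)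
    (g : ℕ → Ω → Letter) (I : ℕ → Ω → ℕ) (c : ℕ → Ω → Bool)
    (h : IsElephantSteps p μ g I c) :
    ∃ Ξ : ℕ → Ω → ℝ,
      -- a zero-mean martingale with bounded increments and asymptotically linear bracket
      Martingale Ξ (stepFiltration g h.measurable_step) μ ∧
      (∀ n, ∫ ω, Ξ n ω ∂μ = 0) ∧
      (∃ C : ℝ, ∀ n ω, |Ξ (n + 1) ω - Ξ n ω| ≤ C) ∧
      (∀ᵐ ω ∂μ, Tendsto
        (fun n : ℕ => predictableQuadVar Ξ (stepFiltration g h.measurable_step) μ n ω / (n : ℝ))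
        atTop (𝓝 1)) ∧
      -- the decomposition of the signed location
      (∀ n ω, (signedLocation g n ω : ℝ) = Ξ n ω + q * alternatingSum g n ω) ∧
      -- the remainder is predictable
      IsStronglyPredictable (stepFiltration g h.measurable_step)
        (fun n ω => (signedLocation g n ω : ℝ) - Ξ n ω) ∧
      -- the limit of the remainder; `Y` is the sum of the infinite series
      ∃ Y Zinf : Ω → ℝ,
        (∀ᵐ ω ∂μ, Tendsto (fun n => alternatingSum g n ω) atTop (𝓝 (Y ω))) ∧
        (∀ ω, Zinf ω = q * Y ω) ∧
        MemLp Zinf 2 μ ∧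
        (∀ᵐ ω ∂μ, Tendsto (fun n => (signedLocation g n ω : ℝ) - Ξ n ω) atTop (𝓝 (Zinf ω))) ∧
        Tendsto (fun n => eLpNorm (fun ω => ((signedLocation g n ω : ℝ) - Ξ n ω) - Zinf ω) 2 μ)
          atTop (𝓝 0) ∧
        ∫ ω, Zinf ω ∂μ = 0 ∧
        -- the variance
        (q ≠ 1 / 2 →
          IntervalIntegrable (fun u : ℝ => (u ^ (-2 * q + 1) - 1) / (1 - u) *
            (((1 - u / 2) ^ (q - 1) - 1) / u)) volume 0 1 ∧
          ∫ ω, Zinf ω ^ 2 ∂μ = q ^ 2 / (2 * q - 1) *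
            ∫ u in (0 : ℝ)..1, (u ^ (-2 * q + 1) - 1) / (1 - u) *
              (((1 - u / 2) ^ (q - 1) - 1) / u)) ∧
        (q = 1 / 2 →
          IntervalIntegrable (fun u : ℝ => -Real.log u / (1 - u) *
            (((1 - u / 2) ^ (-(1 / 2) : ℝ) - 1) / u)) volume 0 1 ∧
          ∫ ω, Zinf ω ^ 2 ∂μ = 1 / 4 *
            ∫ u in (0 : ℝ)..1, -Real.log u / (1 - u) *
              (((1 - u / 2) ^ (-(1 / 2) : ℝ) - 1) / u)) := by
  have hq0 : -1 ≤ q := by linarith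
  have hq1 : q < 1 := by linarith
  have hξ := h.isBoundedMartingaleDiff hq (abs_le.2 ⟨hq0, hq1.le⟩)
  have hrem (n : ℕ) (ω : Ω) : (signedLocation g n ω : ℝ)
      - transform (fun k => (-1) ^ k) (innovation q g) n ω = q * alternatingSum g n ω := by
    rw [signedLocation_eq_transform q]
    ring
  have hincr (n : ℕ) (ω : Ω) : transform (fun k => (-1) ^ k) (innovation q g) (n + 1) ω
      - transform (fun k => (-1) ^ k) (innovation q g) n ω = (-1) ^ n * innovation q g n ω := by
    simp [transform, Finset.sum_range_succ]
  obtain ⟨Y, hY, hYae, hYL2, hY0, hYvar⟩ := h.exists_limit hq hq0 hq1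
  refine ⟨transform (fun k => (-1) ^ k) (innovation q g), hξ.martingale_transform _,
    hξ.integral_transform _, ⟨2, fun n ω => ?_⟩, ?_, signedLocation_eq_transform q g, ?_, Y,
    fun ω => q * Y ω, hYae, fun ω => rfl, hY.const_mul q, ?_, ?_, ?_, fun hq2 => ?_, fun hq2 => ?_⟩
  · rw [hincr, abs_mul, abs_pow, abs_neg, abs_one, one_pow, one_mul]
    exact hξ.abs_bound n ω
  · have hall := ae_all_iff.2 (h.condExp_innovation_sq hq)
    have hsq (n : ℕ) : (fun ω => (transform (fun k => (-1) ^ k) (innovation q g) (n + 1) ω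
        - transform (fun k => (-1) ^ k) (innovation q g) n ω) ^ 2)
        = fun ω => innovation q g n ω ^ 2 := by
      ext ω
      rw [hincr, mul_pow, ← pow_mul, mul_comm n 2, pow_mul]
      simp
    filter_upwards [hall, h.tendsto_meanStep hq hq0 hq1] with ω h1 h2
    have h3 : Tendsto (fun n => 1 - q ^ 2 * meanStep g n ω ^ 2) atTop (𝓝 1) := by
      simpa using ((h2.pow 2).const_mul (q ^ 2)).const_sub 1
    refine h3.cesaro.congr fun n => ?_
    simp only [predictableQuadVar, hsq, h1]
    rw [div_eq_inv_mul]
  · simp only [hrem]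
    refine IsStronglyPredictable.of_measurable_add_one ?_ fun n => ?_
    · simpa [alternatingSum] using stronglyMeasurable_const
    · simp only [alternatingSum_eq_sum_range]
      refine (Finset.stronglyMeasurable_fun_sum _ fun k hk => ?_).const_mul q
      exact ((stronglyMeasurable_meanStep h.measurable_step k).mono
        ((stepFiltration g h.measurable_step).mono
          (Nat.lt_succ_iff.1 (Finset.mem_range.1 hk)))).const_mul _
  · simp only [hrem]
    filter_upwards [hYae] with ω hω using hω.const_mul q
  · simp only [hrem, ← mul_sub]
    have h1 := ENNReal.Tendsto.const_mul (a := ‖q‖ₑ) hYL2 (Or.inr enorm_ne_top)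
    rw [mul_zero] at h1
    refine h1.congr fun n => ?_
    have e : (fun ω => q * (alternatingSum g n ω - Y ω))
        = q • fun ω => alternatingSum g n ω - Y ω := rfl
    rw [e, eLpNorm_const_smul]
  · rw [integral_const_mul, hY0, mul_zero]
  · have hq3 : 2 * q - 1 ≠ 0 := fun h' => hq2 (by linarith)
    obtain ⟨hI, hint⟩ := variance_integral hq1 hYvar
    -- The integrand carries the normalization `2 q - 1` of the kernel outside.
    have e (u : ℝ) : (u ^ (-2 * q + 1) - 1) / (1 - u) * (((1 - u / 2) ^ (q - 1) - 1) / u)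
        = (2 * q - 1) * (varianceKernel q u / (1 - u) * (((1 - u / 2) ^ (q - 1) - 1) / u)) := by
      rw [varianceKernel, if_neg hq2]
      field_simp
    simp only [e]
    refine ⟨hI.const_mul _, ?_⟩
    rw [intervalIntegral.integral_const_mul, hint]
    simp only [mul_pow]
    rw [integral_const_mul, ← mul_assoc, div_mul_cancel₀ _ hq3]
  · obtain ⟨hI, hint⟩ := variance_integral hq1 hYvar
    have e (u : ℝ) : varianceKernel q u / (1 - u) * (((1 - u / 2) ^ (q - 1) - 1) / u)
        = -Real.log u / (1 - u) * (((1 - u / 2) ^ (-(1 / 2) : ℝ) - 1) / u) := by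
      rw [varianceKernel, if_pos hq2, hq2]
      norm_num
    simp only [e] at hI hint
    refine ⟨hI, ?_⟩
    rw [hint]
    simp only [mul_pow]
    rw [integral_const_mul, hq2]
    norm_num
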